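/- Let $V$ be a finite universe, $n=|V|$, let $k\in\mathbb N$, and let $\mathcal F$ be a class of submodular (possibly non-monotone) functions $f:2^V\to\mathbb R_{\ge 0}$, for example the class of all of them, or of all monotone ones. A dynamic algorithm starts from the ground set $V_0=\emptyset$ and processes a sequence of updates fixed in advance (oblivious adversary), each of which inserts an element of $V\setminus V_{t-1}$ into, or deletes an element of $V_{t-1}$ from, the current ground set $V_{t-1}$, giving $V_t$. It is randomized, keeps an unbounded memory, does not know which $f\in\mathcal F$ it works on, and accesses $f$ only by queries of the value $f(A)$ at sets $A\subseteq V$, all of them made during the updates; only these queries are counted. At every time $t$ it reports a set $S_t\subseteq V_t$ with $|S_t|\le k$. The algorithm is *$\tau$-thresholding* on $f$ if, with probability one, at every time $t$: (1) either $|S_t|=k$ and $f(S_t)\ge k\tau$, or $|S_t|<k$ and $f(S_t\cup\{v\})-f(S_t)<\tau$ for all $v\in V_t\setminus S_t$; and (2) $|S_{t+1}\setminus S_t|+|S_t\setminus S_{t+1}|$ is at most the number of queries made during update $t+1$. It is an *$\alpha$-approximation* on $f$ if $\mathbb E[f(S_t)]\ge \mathrm{OPT}_t/\alpha$ at every time $t$,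 where $\mathrm{OPT}_t=\max\{f(S):S\subseteq V_t,\ |S|\le k\}$. It uses $b$ *expected* queries per update if the expected number of queries of every single update is at most $b$, and $b$ *expected amortized* queries per update if, for every $T$, the expected total number of queries of the first $T$ updates is at most $bT$, in both cases for every sequence of updates. **Theorem (Reduction Metatheorem).** Let $g:\mathbb N\times\mathbb N\to\mathbb R_{\ge0}$. Suppose that for every $\tau>0$ there is a dynamic algorithm that, on every $f\in\mathcal F$, is $\tau$-thresholding and uses an expected $O(g(n,k))$ oracle queries per update. Then for every $\varepsilon\in(0,1]$ there are - a dynamic algorithm that is an $(8+\varepsilon)$-approximation on every $f\in\mathcal F$ and uses an expected $O\big(k+\min(k,g(n,k))\cdot g(n,k)\cdot\varepsilon^{-1}\log k\big)$ oracle queries per update, and - a dynamic algorithm that is a $(10+\varepsilon)$-approximation on every $f\in\mathcal F$ and uses an expected $O\big(\min(k,g(n,k))\cdot g(n,k)\cdot\varepsilon^{-1}\log k\big)$ oracle queries per update. Here $\log k$ is read as $\log 2$ for $k=1$. The same holds with "expected amortized" in place of "expected" in both the hypothesis and the conclusions. The constants hidden in the conclusions depend only on the constant hidden in the hypothesis.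 -/

import Mathlib

open scoped NNReal ENNReal

universe u

noncomputable section

/-! ## Submodular functions -/

/-- `f : 2^V → ℝ≥0` is submodular. -/
structure IsNonnegSubmodular {V : Type u} [DecidableEq V] (f : Finset V → ℝ) : Prop where
  nonneg : ∀ A, 0 ≤ f A
  submodular : ∀ A B, f (A ∪ B) + f (A ∩ B) ≤ f A + f B

/-- The optimal value of `f` over the subsets of `W` with at most `k` elements. -/
def optValue {V : Type u} [DecidableEq V] (f : Finset V → ℝ) (k : ℕ) (W : Finset V) : ℝ :=
  (W.powerset.filter (fun S => S.card ≤ k)).sup' ⟨∅, by simp⟩ f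

/-! ## Update sequences -/

/-- An update of the current ground set: the insertion or the deletion of one element. -/
inductive Update (V : Type u) : Type u
  | insert (v : V)
  | delete (v : V)

namespace Update

variable {V : Type u} [DecidableEq V]

/-- The ground set after an update. -/
def apply (W : Finset V) : Update V → Finset V
  | .insert v => Insert.insert v W
  | .delete v => W.erase v

/-- Only absent elements are inserted and only present elements are deleted. -/
def Valid (W : Finset V) : Update V → Prop
  | .insert v => v ∉ W
  | .delete v => v ∈ W

/-- A sequence of updates is valid if it starts from the ground set `W`. -/
def ValidFrom (W : Finset V) : List (Update V) → Prop
  | [] => True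
  | x :: xs => x.Valid W ∧ ValidFrom (x.apply W) xs

/-- A valid sequence of updates, starting from the empty ground set. -/
def ValidSeq (xs : List (Update V)) : Prop := ValidFrom ∅ xs

/-- The current ground set after a sequence of updates, starting from the empty ground set. -/
def ground (xs : List (Update V)) : Finset V := xs.foldl apply ∅

end Update

/-! ## Randomized computations with access to a value oracle -/

/-- A randomized computation that returns an element of `α` and has access to an unknown set
function only by set queries: it stops, or it queries the value at a set `A` and continues
depending on the answer, or it draws a random number from a discrete distribution of its choice
and continues depending on it. Only queries are charged. -/
inductive QueryProg (V : Type u) (α : Type u) : Type u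
  | done (a : α) : QueryProg V α
  | ask (A : Finset V) (next : ℝ → QueryProg V α) : QueryProg V α
  | rand (p : PMF ℕ) (next : ℕ → QueryProg V α) : QueryProg V α

/-- The joint law of the returned value and the number of queries made, when the queries are
answered by `f`. -/
def QueryProg.run {V α : Type u} (f : Finset V → ℝ) : QueryProg V α → PMF (α × ℕ)
  | .done a => PMF.pure (a, 0)
  | .ask A next => ((next (f A)).run f).map (fun x => (x.1, x.2 + 1))
  | .rand p next => p.bind (fun i => (next i).run f)

/-! ## Dynamic algorithms -/

/-- A randomized dynamic algorithm on the universe `V`. It has a memory (which may hold all the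
previous updates, query answers and random choices), processes each update by a randomized
computation with oracle access that returns the new memory, and reports a set depending on its
memory. The initial memory is fixed: no query precedes the first update, and random choices of an
initialization can be made during the first update. -/
structure DynAlg (V : Type u) : Type (u + 1) where
  State : Type u
  init : State
  step : State → Update V → QueryProg V State
  output : State → Finset V

namespace DynAlg

variable {V : Type u}

/-- The law of the memory after the updates `xs`, which are fixed in advance (oblivious
adversary). -/
def stateLaw (A : DynAlg V) (f : Finset V → ℝ) (xs : List (Update V)) : PMF A.State :=
  xs.foldl (fun p x => p.bind (fun s => ((A.step s x).run f).map Prod.fst)) (PMF.pure A.init)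

/-- The joint law of the memory before the update `x`, the memory after it, and the number of
queries made during it, where `x` comes right after the updates `xs`. -/
def updateLaw (A : DynAlg V) (f : Finset V → ℝ) (xs : List (Update V)) (x : Update V) :
    PMF (A.State × A.State × ℕ) :=
  (A.stateLaw f xs).bind (fun s => ((A.step s x).run f).map (fun y => (s, y.1, y.2)))

/-- The expected number of queries made during the update `x` that comes right after `xs`. -/
def expQueries (A : DynAlg V) (f : Finset V → ℝ) (xs : List (Update V)) (x : Update V) : ℝ≥0∞ :=
  ∑' y : A.State × A.State × ℕ, A.updateLaw f xs x y * (y.2.2 : ℝ≥0∞)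

/-- The expected total number of queries made during the sequence of updates `xs`. -/
def expTotalQueries (A : DynAlg V) (f : Finset V → ℝ) (xs : List (Update V)) : ℝ≥0∞ :=
  ∑ t : Fin xs.length, A.expQueries f (xs.take t) (xs.get t)

/-- The expected value of the reported set after the updates `xs` (for `f ≥ 0`). -/
def expValue (A : DynAlg V) (f : Finset V → ℝ) (xs : List (Update V)) : ℝ≥0∞ :=
  ∑' s : A.State, A.stateLaw f xs s * ENNReal.ofReal (f (A.output s))

end DynAlg

/-- The two ways to measure the queries per update: the expectation for each single update, or
the amortized expectation, where the total over a sequence is divided by its length. -/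
inductive QueryMeasure
  | expected
  | expectedAmortized

namespace DynAlg

variable {V : Type u} [DecidableEq V]

/-- On the function `f`, the algorithm makes at most `b` queries per update, in expectation or
in amortized expectation, against every oblivious adversary. -/
def QueriesLE (A : DynAlg V) (f : Finset V → ℝ) (b : ℝ≥0) : QueryMeasure → Prop
  | .expected => ∀ (xs : List (Update V)) (x : Update V), Update.ValidSeq (xs ++ [x]) →
      A.expQueries f xs x ≤ (b : ℝ≥0∞)
  | .expectedAmortized => ∀ xs : List (Update V), Update.ValidSeq xs →
      A.expTotalQueries f xs ≤ (xs.length : ℝ≥0∞) * (b : ℝ≥0∞)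

/-- The algorithm is `τ`-thresholding on `f` under the cardinality constraint `k`. The conditions
hold with probability one at every time of every valid sequence of updates. -/
structure IsThresholding (A : DynAlg V) (f : Finset V → ℝ) (k : ℕ) (τ : ℝ) : Prop where
  subset_ground : ∀ xs : List (Update V), Update.ValidSeq xs →
    ∀ s ∈ (A.stateLaw f xs).support, A.output s ⊆ Update.ground xs
  card_le : ∀ xs : List (Update V), Update.ValidSeq xs →
    ∀ s ∈ (A.stateLaw f xs).support, (A.output s).card ≤ k
  threshold : ∀ xs : List (Update V), Update.ValidSeq xs →
    ∀ s ∈ (A.stateLaw f xs).support,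
      ((A.output s).card = k ∧ (k : ℝ) * τ ≤ f (A.output s)) ∨
      ((A.output s).card < k ∧ ∀ v ∈ Update.ground xs \ A.output s,
        f (insert v (A.output s)) - f (A.output s) < τ)
  change_le : ∀ (xs : List (Update V)) (x : Update V), Update.ValidSeq (xs ++ [x]) →
    ∀ y ∈ (A.updateLaw f xs x).support,
      (A.output y.2.1 \ A.output y.1).card + (A.output y.1 \ A.output y.2.1).card ≤ y.2.2

/-- The algorithm maintains an `α`-approximate solution for maximizing `f` under the cardinality
constraint `k`: at every time of every valid sequence of updates it reports, with probability
one, at most `k` elements of the current ground set, and the expected value of the reported set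
is at least the current optimal value divided by `α`. -/
structure IsApprox (A : DynAlg V) (f : Finset V → ℝ) (k : ℕ) (α : ℝ) : Prop where
  subset_ground : ∀ xs : List (Update V), Update.ValidSeq xs →
    ∀ s ∈ (A.stateLaw f xs).support, A.output s ⊆ Update.ground xs
  card_le : ∀ xs : List (Update V), Update.ValidSeq xs →
    ∀ s ∈ (A.stateLaw f xs).support, (A.output s).card ≤ k
  value_ge : ∀ xs : List (Update V), Update.ValidSeq xs →
    ENNReal.ofReal (optValue f k (Update.ground xs) / α) ≤ A.expValue f xs

end DynAlg

end

/-!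
The plan is to guess the threshold and to run, for each guess, two thresholding algorithms and a
random sampling step. It gives an `(8 + ε)`-approximation within the smaller of the two query
bounds, so that a single algorithm proves both claims.

*One threshold.* Run a `τ`-thresholding algorithm on the ground set `W`, with solution `S₁`, and
another copy on `W \ S₁`, with solution `S₂`. If neither solution is full, then no element can be
added with a gain of `τ`, and submodularity applied to `S₁ ∪ O` and `S₂ ∪ (O \ S₁)` gives
`f O ≤ f S₁ + f S₂ + f (S₁ ∩ O) + 2kτ` for every feasible `O`
(`IsNonnegSubmodular.le_of_marginals`). A uniformly random subset of `S₁` has expected value at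
least `f (S₁ ∩ O) / 4` (`IsNonnegSubmodular.le_sum_powerset`). The second copy receives, per update,
at most one update for the change of `W` plus one for each change of `S₁`, that is, an expected
`1 + min (2k) b` if the algorithm makes `b` queries (`DynAlg.QueriesLE.twice`). These updates depend
on the random choices of the first copy only, so for the second copy they are oblivious
(`DynAlg.stateLaw_follow`).

*All thresholds.* The guesses are `τ = (1 + δ) ^ i` for all integers `i`, with `δ = ε / 2`. An
element `v` is passed on only to the guesses with `τ ≤ f {v} ≤ kτ`, of which there are
`O(ε⁻¹ log k)` (`card_guesses_le`); all other runs are unaffected by `v`. Let `M` be the largest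
value of `∅`, of the present singletons, and of the solutions for all guesses. For the guess with
`M < kτ ≤ (1 + δ) M` no solution is full, no element was left out for being too large, and an
element with `f {v} < τ` has no gain of `τ` either. Hence `OPT ≤ (4 + 2δ) M + f (S₁ ∩ O)`, and the
better of `M` and a random subset of `S₁` is an `(8 + 2δ)`-approximation
(`DynAlg.optValue_le_expect`). Only one random subset has to be evaluated per update.

*Few queries.* The constantly many extra queries per run are absorbed by the bound as `b ≥ 1`: if
some singleton is better than `∅`, its insertion into the empty ground set forces an algorithm with
a small threshold to change its solution and hence to query (`DynAlg.IsThresholding.one_le`). If no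
singleton is better than `∅`, for any of the functions, or if `k = 0`, then the empty solution is
optimal.
-/

noncomputable section

/-! ### Expectations with respect to a discrete law -/

namespace PMF

variable {α β : Type*}

/-- The expectation of `h ≥ 0` under the discrete law `p`. -/
def expect (p : PMF α) (h : α → ℝ≥0∞) : ℝ≥0∞ := ∑' a, p a * h a

theorem expect_pure (a : α) (h : α → ℝ≥0∞) : (PMF.pure a).expect h = h a := by
  classical
  simp [expect, PMF.pure_apply, ite_mul]

theorem expect_bind (p : PMF α) (q : α → PMF β) (h : β → ℝ≥0∞) :
    (p.bind q).expect h = p.expect (fun a => (q a).expect h) := by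
  simp only [expect, PMF.bind_apply, ← ENNReal.tsum_mul_right, ← ENNReal.tsum_mul_left]
  rw [ENNReal.tsum_comm]
  simp only [mul_assoc]

theorem expect_map (p : PMF α) (g : α → β) (h : β → ℝ≥0∞) :
    (p.map g).expect h = p.expect (fun a => h (g a)) := by
  rw [PMF.map, expect_bind]
  simp [expect_pure]

theorem expect_add (p : PMF α) (h h' : α → ℝ≥0∞) :
    p.expect (fun a => h a + h' a) = p.expect h + p.expect h' := by
  simp only [expect, mul_add, ENNReal.tsum_add]

theorem expect_const (p : PMF α) (b : ℝ≥0∞) : p.expect (fun _ => b) = b := by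
  simp [expect, ENNReal.tsum_mul_right, PMF.tsum_coe]

theorem expect_mul_const (p : PMF α) (h : α → ℝ≥0∞) (b : ℝ≥0∞) :
    p.expect (fun a => h a * b) = p.expect h * b := by
  simp only [expect, ← ENNReal.tsum_mul_right, mul_assoc]

theorem expect_mono {p : PMF α} {h h' : α → ℝ≥0∞} (H : ∀ a ∈ p.support, h a ≤ h' a) :
    p.expect h ≤ p.expect h' := by
  refine ENNReal.tsum_le_tsum fun a => ?_
  by_cases ha : p a = 0
  · simp [ha]
  · exact mul_le_mul_right (H a ha) _

theorem expect_congr {p : PMF α} {h h' : α → ℝ≥0∞} (H : ∀ a ∈ p.support, h a = h' a) :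
    p.expect h = p.expect h' :=
  le_antisymm (expect_mono fun a ha => (H a ha).le) (expect_mono fun a ha => (H a ha).ge)

theorem expect_comm (p : PMF α) (q : PMF β) (h : α → β → ℝ≥0∞) :
    p.expect (fun a => q.expect (h a)) = q.expect (fun b => p.expect (fun a => h a b)) := by
  simp only [expect, ← ENNReal.tsum_mul_left]
  rw [ENNReal.tsum_comm]
  simp only [mul_left_comm]

theorem expect_sum {ι : Type*} (p : PMF α) (s : Finset ι) (h : ι → α → ℝ≥0∞) :
    p.expect (fun a => ∑ i ∈ s, h i a) = ∑ i ∈ s, p.expect (h i) := by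
  classical
  induction s using Finset.induction_on with
  | empty => simp [expect]
  | insert i s hi ih => simp only [Finset.sum_insert hi, expect_add, ih]

theorem bind_congr_support {p : PMF α} {q q' : α → PMF β} (H : ∀ a ∈ p.support, q a = q' a) :
    p.bind q = p.bind q' := by
  ext b
  simp only [PMF.bind_apply]
  refine tsum_congr fun a => ?_
  by_cases ha : p a = 0
  · simp [ha]
  · rw [H a ha]

end PMF

/-! ### Programs: sequencing, law of the result, expected cost -/

namespace QueryProg

variable {V α β : Type u}

/-- Run a program and continue with another one that depends on the result. -/
def bind : QueryProg V α → (α → QueryProg V β) → QueryProg V β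
  | .done a, q => q a
  | .ask A next, q => .ask A (fun r => (next r).bind q)
  | .rand p next, q => .rand p (fun i => (next i).bind q)

/-- The law of the returned value. -/
def result (f : Finset V → ℝ) (p : QueryProg V α) : PMF α := (p.run f).map Prod.fst

/-- The expected number of queries. -/
def cost (f : Finset V → ℝ) (p : QueryProg V α) : ℝ≥0∞ := (p.run f).expect (fun y => (y.2 : ℝ≥0∞))

variable (f : Finset V → ℝ)

theorem result_done (a : α) : (done a : QueryProg V α).result f = PMF.pure a := by
  simp [result, run, PMF.pure_map]

theorem cost_done (a : α) : (done a : QueryProg V α).cost f = 0 := by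
  simp [cost, run, PMF.expect_pure]

theorem result_ask (A : Finset V) (next : ℝ → QueryProg V α) :
    (ask A next).result f = (next (f A)).result f := by
  simp [result, run, PMF.map_comp, Function.comp_def]

theorem cost_ask (A : Finset V) (next : ℝ → QueryProg V α) :
    (ask A next).cost f = (next (f A)).cost f + 1 := by
  simp [cost, run, PMF.expect_map, PMF.expect_add, PMF.expect_const]

theorem result_rand (p : PMF ℕ) (next : ℕ → QueryProg V α) :
    (rand p next).result f = p.bind (fun i => (next i).result f) := by
  simp [result, run, PMF.map_bind]

theorem cost_rand (p : PMF ℕ) (next : ℕ → QueryProg V α) :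
    (rand p next).cost f = p.expect (fun i => (next i).cost f) := by
  simp [cost, run, PMF.expect_bind]

theorem result_bind (p : QueryProg V α) (q : α → QueryProg V β) :
    (p.bind q).result f = (p.result f).bind (fun a => (q a).result f) := by
  induction p with
  | done a => simp [bind, result_done]
  | ask A next ih => simp [bind, result_ask, ih]
  | rand p next ih => simp [bind, result_rand, ih]

theorem cost_bind (p : QueryProg V α) (q : α → QueryProg V β) :
    (p.bind q).cost f = p.cost f + (p.result f).expect (fun a => (q a).cost f) := by
  induction p with
  | done a => simp [bind, result_done, cost_done, PMF.expect_pure]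
  | ask A next ih => simp [bind, result_ask, cost_ask, ih, add_right_comm]
  | rand p next ih => simp [bind, result_rand, cost_rand, ih, PMF.expect_bind, PMF.expect_add]

end QueryProg

/-! ### Laws and costs of dynamic algorithms -/

namespace DynAlg

variable {V : Type u} (A : DynAlg V) (f : Finset V → ℝ)

theorem stateLaw_nil : A.stateLaw f [] = PMF.pure A.init := rfl

theorem stateLaw_append_singleton (xs : List (Update V)) (x : Update V) :
    A.stateLaw f (xs ++ [x]) = (A.stateLaw f xs).bind (fun s => (A.step s x).result f) := by
  simp [stateLaw, QueryProg.result, List.foldl_append]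

theorem expQueries_eq (xs : List (Update V)) (x : Update V) :
    A.expQueries f xs x = (A.stateLaw f xs).expect (fun s => (A.step s x).cost f) := by
  change (A.updateLaw f xs x).expect (fun y => (y.2.2 : ℝ≥0∞)) = _
  simp [updateLaw, PMF.expect_bind, PMF.expect_map, QueryProg.cost]

theorem expTotalQueries_nil : A.expTotalQueries f [] = 0 := by
  simp [expTotalQueries]

theorem expTotalQueries_append_singleton (xs : List (Update V)) (x : Update V) :
    A.expTotalQueries f (xs ++ [x]) = A.expTotalQueries f xs + A.expQueries f xs x := by
  have key : ∀ ys : List (Update V), A.expTotalQueries f ys = ∑ t ∈ Finset.range ys.length,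
      if h : t < ys.length then A.expQueries f (ys.take t) ys[t] else 0 := by
    intro ys
    rw [expTotalQueries, Finset.sum_range]
    simp
  rw [key, key, show Finset.range (xs ++ [x]).length = Finset.range (xs.length + 1) by simp,
    Finset.sum_range_succ]
  congr 1
  · refine Finset.sum_congr rfl fun t ht => ?_
    have ht := Finset.mem_range.1 ht
    rw [dif_pos (by simp; omega), dif_pos ht, List.take_append_of_le_length ht.le,
      List.getElem_append_left ht]
  · simp

/-- The program that processes a list of updates one after the other. -/
def steps (s : A.State) : List (Update V) → QueryProg V A.State
  | [] => .done s
  | x :: xs => (A.step s x).bind (fun s' => steps s' xs)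

/-- The expected number of queries made on the updates `ys` that come right after `xs`. -/
def blockQueries (xs ys : List (Update V)) : ℝ≥0∞ :=
  (A.stateLaw f xs).expect (fun s => (A.steps s ys).cost f)

theorem stateLaw_append (xs ys : List (Update V)) :
    A.stateLaw f (xs ++ ys) = (A.stateLaw f xs).bind (fun s => (A.steps s ys).result f) := by
  induction ys generalizing xs with
  | nil => simp [steps, QueryProg.result_done]
  | cons y ys ih =>
    rw [List.append_cons, ih, stateLaw_append_singleton, PMF.bind_bind]
    simp [steps, QueryProg.result_bind]

theorem blockQueries_nil (xs : List (Update V)) : A.blockQueries f xs [] = 0 := by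
  simp [blockQueries, steps, QueryProg.cost_done, PMF.expect_const]

theorem blockQueries_cons (xs ys : List (Update V)) (y : Update V) :
    A.blockQueries f xs (y :: ys) = A.expQueries f xs y + A.blockQueries f (xs ++ [y]) ys := by
  simp [blockQueries, steps, QueryProg.cost_bind, PMF.expect_add, expQueries_eq,
    stateLaw_append_singleton, PMF.expect_bind]

theorem expTotalQueries_append (xs ys : List (Update V)) :
    A.expTotalQueries f (xs ++ ys) = A.expTotalQueries f xs + A.blockQueries f xs ys := by
  induction ys generalizing xs with
  | nil => simp [blockQueries_nil]
  | cons y ys ih =>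
    rw [List.append_cons, ih, expTotalQueries_append_singleton, blockQueries_cons, add_assoc]

end DynAlg

/-! ### Valid update sequences -/

namespace Update

variable {V : Type u}

/-- The element that is inserted or deleted. -/
def elem : Update V → V
  | .insert v => v
  | .delete v => v

variable [DecidableEq V]

theorem validFrom_append (W : Finset V) (xs ys : List (Update V)) :
    ValidFrom W (xs ++ ys) ↔ ValidFrom W xs ∧ ValidFrom (xs.foldl apply W) ys := by
  induction xs generalizing W with
  | nil => simp [ValidFrom]
  | cons x xs ih => simp [ValidFrom, ih, and_assoc]

theorem ground_append_singleton (xs : List (Update V)) (x : Update V) :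
    ground (xs ++ [x]) = x.apply (ground xs) := by
  simp [ground, List.foldl_append]

theorem validSeq_append_singleton (xs : List (Update V)) (x : Update V) :
    ValidSeq (xs ++ [x]) ↔ ValidSeq xs ∧ x.Valid (ground xs) := by
  simp [ValidSeq, validFrom_append, ValidFrom, ground]

theorem ValidSeq.of_append {xs ys : List (Update V)} (h : ValidSeq (xs ++ ys)) : ValidSeq xs :=
  ((validFrom_append _ _ _).1 h).1

/-- The updates that turn the ground set `U` into `U'`. -/
def diff (U U' : Finset V) : List (Update V) :=
  (U \ U').toList.map .delete ++ (U' \ U).toList.map .insert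

theorem length_diff (U U' : Finset V) : (diff U U').length = (U \ U').card + (U' \ U).card := by
  simp [diff]

theorem deletes_spec (l : List V) (hl : l.Nodup) (U : Finset V) (h : ∀ v ∈ l, v ∈ U) :
    ValidFrom U (l.map .delete) ∧ (l.map .delete).foldl apply U = U \ l.toFinset := by
  induction l generalizing U with
  | nil => simp [ValidFrom]
  | cons v l ih =>
    rw [List.nodup_cons] at hl
    obtain ⟨h1, h2⟩ := ih hl.2 (U.erase v) fun w hw => Finset.mem_erase.2
      ⟨fun e => hl.1 (e ▸ hw), h w (List.mem_cons_of_mem _ hw)⟩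
    refine ⟨⟨h v List.mem_cons_self, h1⟩, ?_⟩
    simp only [List.map_cons, List.foldl_cons]
    rw [apply, h2]
    ext w
    simp only [Finset.mem_sdiff, Finset.mem_erase, List.mem_toFinset, List.mem_cons]
    tauto

theorem inserts_spec (l : List V) (hl : l.Nodup) (U : Finset V) (h : ∀ v ∈ l, v ∉ U) :
    ValidFrom U (l.map .insert) ∧ (l.map .insert).foldl apply U = U ∪ l.toFinset := by
  induction l generalizing U with
  | nil => simp [ValidFrom]
  | cons v l ih =>
    rw [List.nodup_cons] at hl
    obtain ⟨h1, h2⟩ := ih hl.2 (Insert.insert v U) fun w hw => by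
      rw [Finset.mem_insert, not_or]
      exact ⟨fun e => hl.1 (e ▸ hw), h w (List.mem_cons_of_mem _ hw)⟩
    refine ⟨⟨h v List.mem_cons_self, h1⟩, ?_⟩
    simp only [List.map_cons, List.foldl_cons]
    rw [apply, h2]
    ext w
    simp only [Finset.mem_union, Finset.mem_insert, List.mem_toFinset, List.mem_cons]
    tauto

theorem diff_spec (U U' : Finset V) :
    ValidFrom U (diff U U') ∧ (diff U U').foldl apply U = U' := by
  obtain ⟨h1, h2⟩ := deletes_spec (U \ U').toList (Finset.nodup_toList _) U
    fun v hv => (Finset.mem_sdiff.1 (Finset.mem_toList.1 hv)).1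
  obtain ⟨h3, h4⟩ := inserts_spec (U' \ U).toList (Finset.nodup_toList _)
    (U \ (U \ U').toList.toFinset) fun v hv => by
      have := Finset.mem_sdiff.1 (Finset.mem_toList.1 hv)
      simp [this.2]
  rw [diff, validFrom_append, List.foldl_append, h2]
  refine ⟨⟨h1, h3⟩, h4.trans ?_⟩
  ext w
  simp only [Finset.toList_toFinset, Finset.mem_union, Finset.mem_sdiff]
  tauto

/-- Keeping only the updates of the elements with a given property restricts the ground set to
these elements and keeps the sequence valid. -/
theorem filter_spec (P : V → Prop) [DecidablePred P] (xs : List (Update V)) (h : ValidSeq xs) :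
    ValidSeq (xs.filter fun x => P x.elem) ∧
      ground (xs.filter fun x => P x.elem) = (ground xs).filter P := by
  induction xs using List.reverseRecOn with
  | nil => simp [ValidSeq, ValidFrom, ground]
  | append_singleton xs x ih =>
    rw [validSeq_append_singleton] at h
    obtain ⟨h1, h2⟩ := ih h.1
    rw [List.filter_append, ground_append_singleton]
    by_cases hx : P x.elem
    · rw [List.filter_singleton, decide_eq_true hx, cond_true, validSeq_append_singleton,
        ground_append_singleton, h2]
      cases x with
      | insert v =>
        have h3 := h.2
        simp only [Valid, elem] at h3 hx
        refine ⟨⟨h1, by simp [Valid, h3]⟩, ?_⟩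
        simp [apply, Finset.filter_insert, hx]
      | delete v =>
        have h3 := h.2
        simp only [Valid, elem] at h3 hx
        refine ⟨⟨h1, by simp [Valid, h3, hx]⟩, ?_⟩
        simp [apply, Finset.filter_erase]
    · rw [List.filter_singleton, decide_eq_false hx, cond_false, List.append_nil, h2]
      refine ⟨h1, ?_⟩
      cases x with
      | insert v =>
        simp only [elem] at hx
        simp [apply, Finset.filter_insert, hx]
      | delete v =>
        simp only [elem] at hx
        simp [apply, Finset.filter_erase, hx]

end Update

/-! ### Extending a dynamic algorithm -/

namespace DynAlg

variable {V : Type u}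

/-- A map between memories that commutes with the steps transports the law of the memory. -/
theorem map_stateLaw {D D' : DynAlg V} (f : Finset V → ℝ) (φ : D'.State → D.State)
    (hinit : φ D'.init = D.init)
    (hstep : ∀ s x, ((D'.step s x).result f).map φ = (D.step (φ s) x).result f)
    (xs : List (Update V)) : (D'.stateLaw f xs).map φ = D.stateLaw f xs := by
  induction xs using List.reverseRecOn with
  | nil => simp [stateLaw_nil, PMF.pure_map, hinit]
  | append_singleton xs x ih =>
    simp only [stateLaw_append_singleton, ← ih, PMF.map_bind, PMF.bind_map, hstep,
      Function.comp_def]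

theorem QueriesLE.of_expQueries_le [DecidableEq V] {D D' : DynAlg V} {f : Finset V → ℝ} {a b : ℝ≥0}
    {m : QueryMeasure} (h : D.QueriesLE f b m)
    (H : ∀ xs x, D'.expQueries f xs x ≤ D.expQueries f xs x + a) : D'.QueriesLE f (b + a) m := by
  cases m with
  | expected =>
    intro xs x hx
    rw [ENNReal.coe_add]
    exact (H xs x).trans (add_le_add_left (h xs x hx) _)
  | expectedAmortized =>
    intro xs hxs
    have key : ∀ ys : List (Update V),
        D'.expTotalQueries f ys ≤ D.expTotalQueries f ys + ys.length * a := by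
      intro ys
      induction ys using List.reverseRecOn with
      | nil => simp [expTotalQueries_nil]
      | append_singleton ys y ih =>
        rw [expTotalQueries_append_singleton, expTotalQueries_append_singleton]
        refine (add_le_add ih (H ys y)).trans (le_of_eq ?_)
        simp only [List.length_append, List.length_singleton]
        push_cast
        ring
    refine (key xs).trans ?_
    rw [ENNReal.coe_add, mul_add]
    exact add_le_add_left (h xs hxs) _

/-- The algorithm that runs `D` and, after each update, queries the value at the set `o s`, where
`s` is the memory of `D`. The value `0` is stored before the first update. -/
abbrev observe (D : DynAlg V) (o : D.State → Finset V) : DynAlg V where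
  State := D.State × ℝ
  init := (D.init, 0)
  step q x := (D.step q.1 x).bind fun s => .ask (o s) fun r => .done (s, r)
  output q := D.output q.1

section observe

variable (D : DynAlg V) (o : D.State → Finset V) (f : Finset V → ℝ)

theorem result_observe_step (q : (D.observe o).State) (x : Update V) :
    ((D.observe o).step q x).result f = ((D.step q.1 x).result f).map fun s => (s, f (o s)) := by
  simp only [observe, QueryProg.result_bind, QueryProg.result_ask, QueryProg.result_done]
  rfl

theorem map_stateLaw_observe (xs : List (Update V)) :
    ((D.observe o).stateLaw f xs).map Prod.fst = D.stateLaw f xs :=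
  map_stateLaw (D' := D.observe o) f Prod.fst rfl (fun s x => by
    rw [result_observe_step, PMF.map_comp]; exact PMF.map_id _) xs

theorem expQueries_observe (xs : List (Update V)) (x : Update V) :
    (D.observe o).expQueries f xs x = D.expQueries f xs x + 1 := by
  rw [expQueries_eq, expQueries_eq, ← map_stateLaw_observe D o f, PMF.expect_map]
  simp only [observe, QueryProg.cost_bind, QueryProg.cost_ask, QueryProg.cost_done, zero_add,
    PMF.expect_add, PMF.expect_const]

theorem mem_support_observe {xs : List (Update V)} {q : (D.observe o).State}
    (hq : q ∈ ((D.observe o).stateLaw f xs).support) :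
    q.1 ∈ (D.stateLaw f xs).support ∧ (q.2 = f (o q.1) ∨ (xs = [] ∧ q.2 = 0)) := by
  constructor
  · rw [← map_stateLaw_observe D o f, PMF.mem_support_map_iff]
    exact ⟨q, hq, rfl⟩
  · rcases List.eq_nil_or_concat' xs with rfl | ⟨xs, x, rfl⟩
    · right
      rw [stateLaw_nil, PMF.mem_support_pure_iff] at hq
      subst hq
      exact ⟨rfl, rfl⟩
    · left
      rw [stateLaw_append_singleton, PMF.mem_support_bind_iff] at hq
      obtain ⟨q', -, hq⟩ := hq
      rw [result_observe_step, PMF.mem_support_map_iff] at hq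
      obtain ⟨s, -, rfl⟩ := hq
      rfl

end observe

/-! ### Feeding a second algorithm with updates produced by a first one -/

/-- The algorithm that runs `P` and feeds to `A` the sequence of updates `feed p`, where `p` is the
memory of `P`: after each step of `P` it passes on the part of this sequence that is new. -/
abbrev follow (P A : DynAlg V) (feed : P.State → List (Update V)) : DynAlg V where
  State := P.State × A.State
  init := (P.init, A.init)
  step q x := (P.step q.1 x).bind fun p =>
    (A.steps q.2 ((feed p).drop (feed q.1).length)).bind fun s => .done (p, s)
  output q := P.output q.1

section follow

variable {P A : DynAlg V} {feed : P.State → List (Update V)} {f : Finset V → ℝ}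

/-- As `P` does not depend on `A`, the updates fed to `A` are chosen obliviously: given the memory
`p` of `P`, the memory of `A` has the law that belongs to the fixed sequence `feed p`. -/
theorem stateLaw_follow (hinit : feed P.init = [])
    (hstep : ∀ p x, ∀ p' ∈ ((P.step p x).result f).support, feed p <+: feed p')
    (xs : List (Update V)) :
    (P.follow A feed).stateLaw f xs =
      (P.stateLaw f xs).bind fun p => (A.stateLaw f (feed p)).map fun s => (p, s) := by
  induction xs using List.reverseRecOn with
  | nil => simp [stateLaw_nil, hinit, PMF.pure_map, follow]
  | append_singleton xs x ih =>
    rw [stateLaw_append_singleton, stateLaw_append_singleton, ih, PMF.bind_bind, PMF.bind_bind]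
    congr 1
    funext p
    rw [PMF.bind_map]
    simp only [follow, Function.comp_def, QueryProg.result_bind, QueryProg.result_done]
    rw [PMF.bind_comm]
    refine PMF.bind_congr_support fun p' hp' => ?_
    obtain ⟨t, ht⟩ := hstep p x p' hp'
    rw [← ht, List.drop_left, stateLaw_append, ← PMF.bind_bind]
    rfl

theorem expQueries_follow (hinit : feed P.init = [])
    (hstep : ∀ p x, ∀ p' ∈ ((P.step p x).result f).support, feed p <+: feed p')
    (xs : List (Update V)) (x : Update V) :
    (P.follow A feed).expQueries f xs x = P.expQueries f xs x +
      (P.stateLaw f xs).expect fun p => ((P.step p x).result f).expect fun p' =>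
        A.blockQueries f (feed p) ((feed p').drop (feed p).length) := by
  rw [expQueries_eq, expQueries_eq, stateLaw_follow hinit hstep, PMF.expect_bind,
    ← PMF.expect_add]
  congr 1
  funext p
  rw [PMF.expect_map]
  simp only [follow, QueryProg.cost_bind, QueryProg.cost_done, PMF.expect_add, PMF.expect_const,
    add_zero]
  rw [PMF.expect_comm]
  rfl

theorem expTotalQueries_follow (hinit : feed P.init = [])
    (hstep : ∀ p x, ∀ p' ∈ ((P.step p x).result f).support, feed p <+: feed p')
    (xs : List (Update V)) :
    (P.follow A feed).expTotalQueries f xs = P.expTotalQueries f xs +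
      (P.stateLaw f xs).expect fun p => A.expTotalQueries f (feed p) := by
  induction xs using List.reverseRecOn with
  | nil => simp [expTotalQueries_nil, stateLaw_nil, PMF.expect_pure, hinit]
  | append_singleton xs x ih =>
    rw [expTotalQueries_append_singleton, expTotalQueries_append_singleton, ih,
      expQueries_follow hinit hstep, stateLaw_append_singleton, PMF.expect_bind,
      add_add_add_comm, ← PMF.expect_add]
    congr 2
    funext p
    rw [← PMF.expect_const ((P.step p x).result f) (A.expTotalQueries f (feed p)),
      ← PMF.expect_add]
    refine PMF.expect_congr fun p' hp' => ?_
    obtain ⟨t, ht⟩ := hstep p x p' hp'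
    rw [← ht, List.drop_left, expTotalQueries_append]

end follow

/-! ### Two thresholding solutions, the second one outside of the first -/

section residual

variable [DecidableEq V]

/-- The algorithm that runs `A` and records a sequence of updates whose ground set is the
complement of the solution of `A` in the ground set of `A`. -/
abbrev withResidual (A : DynAlg V) : DynAlg V where
  State := A.State × List (Update V)
  init := (A.init, [])
  step p x := (A.step p.1 x).bind fun s => .done (s, p.2 ++ Update.diff (Update.ground p.2)
    (x.apply (Update.ground p.2 ∪ A.output p.1) \ A.output s))
  output p := A.output p.1

variable {A : DynAlg V} {f : Finset V → ℝ}

theorem result_withResidual_step (p : A.withResidual.State) (x : Update V) :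
    (A.withResidual.step p x).result f = ((A.step p.1 x).result f).map fun s =>
      (s, p.2 ++ Update.diff (Update.ground p.2)
        (x.apply (Update.ground p.2 ∪ A.output p.1) \ A.output s)) := by
  simp only [withResidual, QueryProg.result_bind, QueryProg.result_done]
  rfl

theorem map_stateLaw_withResidual (xs : List (Update V)) :
    (A.withResidual.stateLaw f xs).map Prod.fst = A.stateLaw f xs :=
  map_stateLaw (D' := A.withResidual) f Prod.fst rfl (fun s x => by
    rw [result_withResidual_step, PMF.map_comp]; exact PMF.map_id _) xs

theorem expQueries_withResidual (xs : List (Update V)) (x : Update V) :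
    A.withResidual.expQueries f xs x = A.expQueries f xs x := by
  rw [expQueries_eq, expQueries_eq, ← map_stateLaw_withResidual (A := A), PMF.expect_map]
  simp only [withResidual, QueryProg.cost_bind, QueryProg.cost_done, PMF.expect_const, add_zero]

theorem expTotalQueries_withResidual (xs : List (Update V)) :
    A.withResidual.expTotalQueries f xs = A.expTotalQueries f xs := by
  induction xs using List.reverseRecOn with
  | nil => simp [expTotalQueries_nil]
  | append_singleton xs x ih =>
    rw [expTotalQueries_append_singleton, expTotalQueries_append_singleton, ih,
      expQueries_withResidual]

theorem prefix_withResidual_step (p : A.withResidual.State) (x : Update V)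
    (p' : A.withResidual.State) (hp' : p' ∈ ((A.withResidual.step p x).result f).support) :
    p.2 <+: p'.2 := by
  rw [result_withResidual_step, PMF.mem_support_map_iff] at hp'
  obtain ⟨s, -, rfl⟩ := hp'
  exact List.prefix_append _ _

theorem mem_support_withResidual
    (hsub : ∀ xs : List (Update V), Update.ValidSeq xs →
      ∀ s ∈ (A.stateLaw f xs).support, A.output s ⊆ Update.ground xs)
    {xs : List (Update V)} (hxs : Update.ValidSeq xs) {p : A.withResidual.State}
    (hp : p ∈ (A.withResidual.stateLaw f xs).support) :
    p.1 ∈ (A.stateLaw f xs).support ∧ Update.ValidSeq p.2 ∧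
      Update.ground p.2 = Update.ground xs \ A.output p.1 := by
  refine ⟨?_, ?_⟩
  · rw [← map_stateLaw_withResidual, PMF.mem_support_map_iff]
    exact ⟨p, hp, rfl⟩
  induction xs using List.reverseRecOn generalizing p with
  | nil =>
    rw [stateLaw_nil, PMF.mem_support_pure_iff] at hp
    subst hp
    simp [Update.ValidSeq, Update.ValidFrom, Update.ground]
  | append_singleton xs x ih =>
    have hxs' := hxs.of_append
    rw [stateLaw_append_singleton, PMF.mem_support_bind_iff] at hp
    obtain ⟨p', hp', hp⟩ := hp
    obtain ⟨h1, h2⟩ := ih hxs' hp'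
    rw [result_withResidual_step, PMF.mem_support_map_iff] at hp
    obtain ⟨s, -, rfl⟩ := hp
    have hs : p'.1 ∈ (A.stateLaw f xs).support := by
      rw [← map_stateLaw_withResidual, PMF.mem_support_map_iff]
      exact ⟨p', hp', rfl⟩
    have h3 := Update.diff_spec (Update.ground p'.2)
      (x.apply (Update.ground p'.2 ∪ A.output p'.1) \ A.output s)
    refine ⟨(Update.validFrom_append _ _ _).2 ⟨h1, h3.1⟩, ?_⟩
    rw [Update.ground, List.foldl_append]
    refine h3.2.trans ?_
    rw [h2, Finset.sdiff_union_of_subset (hsub xs hxs' _ hs), Update.ground_append_singleton]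

/-- The complement of the solution changes by the update itself and by the changes of the
solution. -/
theorem length_diff_sdiff_le (W S S' : Finset V) (x : Update V) :
    (Update.diff (W \ S) (x.apply W \ S')).length ≤ 1 + ((S' \ S).card + (S \ S').card) := by
  rw [Update.length_diff]
  cases x with
  | insert a =>
    have h1 : (W \ S) \ (Update.apply W (.insert a) \ S') ⊆ S' \ S := by
      intro v
      simp only [Update.apply, Finset.mem_sdiff, Finset.mem_insert]
      tauto
    have h2 : (Update.apply W (.insert a) \ S') \ (W \ S) ⊆ insert a (S \ S') := by
      intro v
      simp only [Update.apply, Finset.mem_sdiff, Finset.mem_insert]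
      tauto
    have := Finset.card_le_card h1
    have := (Finset.card_le_card h2).trans (Finset.card_insert_le _ _)
    omega
  | delete a =>
    have h1 : (W \ S) \ (Update.apply W (.delete a) \ S') ⊆ insert a (S' \ S) := by
      intro v
      simp only [Update.apply, Finset.mem_sdiff, Finset.mem_insert, Finset.mem_erase]
      tauto
    have h2 : (Update.apply W (.delete a) \ S') \ (W \ S) ⊆ S \ S' := by
      intro v
      simp only [Update.apply, Finset.mem_sdiff, Finset.mem_erase]
      tauto
    have := (Finset.card_le_card h1).trans (Finset.card_insert_le _ _)
    have := Finset.card_le_card h2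
    omega

variable {k : ℕ} {τ : ℝ}

theorem expect_change_le (hA : A.IsThresholding f k τ) {xs : List (Update V)} {x : Update V}
    (hx : Update.ValidSeq (xs ++ [x])) :
    ((A.stateLaw f xs).expect fun s => ((A.step s x).result f).expect fun s' =>
      (((A.output s' \ A.output s).card + (A.output s \ A.output s').card : ℕ) : ℝ≥0∞)) ≤
      A.expQueries f xs x := by
  calc _ = (A.updateLaw f xs x).expect fun y =>
        (((A.output y.2.1 \ A.output y.1).card + (A.output y.1 \ A.output y.2.1).card : ℕ) :
          ℝ≥0∞) := by
        simp only [updateLaw, PMF.expect_bind, PMF.expect_map, QueryProg.result]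
    _ ≤ (A.updateLaw f xs x).expect fun y => (y.2.2 : ℝ≥0∞) :=
        PMF.expect_mono fun y hy => by exact_mod_cast hA.change_le xs x hx y hy

/-- Each update produces in expectation at most `1 + min (2k) q` updates of the complement, where
`q` is the expected number of queries of `A`. -/
theorem expect_residual_le (hA : A.IsThresholding f k τ) {xs : List (Update V)} {x : Update V}
    (hx : Update.ValidSeq (xs ++ [x])) :
    ((A.withResidual.stateLaw f xs).expect fun p =>
      ((A.withResidual.step p x).result f).expect fun p' =>
        ((p'.2.drop p.2.length).length : ℝ≥0∞)) ≤ 1 + min (2 * k : ℝ≥0∞) (A.expQueries f xs x) := by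
  have hxs := hx.of_append
  have h1 : ∀ p ∈ (A.withResidual.stateLaw f xs).support,
      ∀ s ∈ ((A.step p.1 x).result f).support,
      ((Update.diff (Update.ground p.2)
        (x.apply (Update.ground p.2 ∪ A.output p.1) \ A.output s)).length : ℝ≥0∞) ≤
      1 + (((A.output s \ A.output p.1).card + (A.output p.1 \ A.output s).card : ℕ) : ℝ≥0∞) ∧
      (((A.output s \ A.output p.1).card + (A.output p.1 \ A.output s).card : ℕ) : ℝ≥0∞) ≤
        2 * k := by
    intro p hp s hs
    obtain ⟨h1, -, h3⟩ := mem_support_withResidual hA.subset_ground hxs hp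
    constructor
    · rw [h3, Finset.sdiff_union_of_subset (hA.subset_ground xs hxs _ h1)]
      exact_mod_cast length_diff_sdiff_le _ _ _ _
    · have h4 := hA.card_le xs hxs _ h1
      have h5 := hA.card_le _ hx s (by
        rw [stateLaw_append_singleton, PMF.mem_support_bind_iff]
        exact ⟨_, h1, hs⟩)
      have h6 := Finset.card_le_card (Finset.sdiff_subset (s := A.output s) (t := A.output p.1))
      have h7 := Finset.card_le_card (Finset.sdiff_subset (s := A.output p.1) (t := A.output s))
      have : (A.output s \ A.output p.1).card + (A.output p.1 \ A.output s).card ≤ 2 * k := by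
        omega
      exact_mod_cast this
  have h2 : ∀ p ∈ (A.withResidual.stateLaw f xs).support,
      (((A.withResidual.step p x).result f).expect fun p' =>
        ((p'.2.drop p.2.length).length : ℝ≥0∞)) ≤
      ((A.step p.1 x).result f).expect fun s => 1 +
        (((A.output s \ A.output p.1).card + (A.output p.1 \ A.output s).card : ℕ) : ℝ≥0∞) := by
    intro p hp
    rw [result_withResidual_step, PMF.expect_map]
    refine PMF.expect_mono fun s hs => ?_
    simp only [List.drop_left]
    exact (h1 p hp s hs).1
  refine (PMF.expect_mono h2).trans ?_
  simp only [PMF.expect_add, PMF.expect_const]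
  refine add_le_add_right (le_min ?_ ?_) _
  · refine (PMF.expect_mono fun p hp => PMF.expect_mono fun s hs => (h1 p hp s hs).2).trans ?_
    simp only [PMF.expect_const, le_refl]
  · refine le_trans (le_of_eq ?_) (expect_change_le hA hx)
    rw [← map_stateLaw_withResidual (A := A), PMF.expect_map]

/-- The algorithm that runs `A` on the ground set and a second copy of `A` on the complement of
the solution of the first copy. -/
abbrev twice (A : DynAlg V) : DynAlg V := A.withResidual.follow A Prod.snd

theorem mem_support_twice (hA : A.IsThresholding f k τ)
    {xs : List (Update V)} (hxs : Update.ValidSeq xs) {q : A.twice.State}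
    (hq : q ∈ (A.twice.stateLaw f xs).support) :
    q.1.1 ∈ (A.stateLaw f xs).support ∧
      ∃ ys, Update.ValidSeq ys ∧ Update.ground ys = Update.ground xs \ A.output q.1.1 ∧
        q.2 ∈ (A.stateLaw f ys).support := by
  rw [stateLaw_follow rfl prefix_withResidual_step, PMF.mem_support_bind_iff] at hq
  obtain ⟨p, hp, hq⟩ := hq
  rw [PMF.mem_support_map_iff] at hq
  obtain ⟨s, hs, rfl⟩ := hq
  obtain ⟨h1, h2, h3⟩ := mem_support_withResidual hA.subset_ground hxs hp
  exact ⟨h1, p.2, h2, h3, hs⟩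

theorem blockQueries_le_of_expected {b : ℝ≥0} (hb : A.QueriesLE f b .expected)
    (xs ys : List (Update V)) (h : Update.ValidSeq (xs ++ ys)) :
    A.blockQueries f xs ys ≤ ys.length * b := by
  induction ys generalizing xs with
  | nil => simp [blockQueries_nil]
  | cons y ys ih =>
    rw [List.append_cons] at h
    rw [blockQueries_cons, List.length_cons, Nat.cast_succ, add_mul, one_mul, add_comm]
    exact add_le_add (ih _ h) (hb xs y h.of_append)

theorem QueriesLE.twice {b : ℝ≥0} {m : QueryMeasure} (hA : A.IsThresholding f k τ)
    (hb : A.QueriesLE f b m) :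
    A.twice.QueriesLE f (b + (1 + min (2 * k : ℝ≥0) b) * b) m := by
  cases m with
  | expected =>
    intro xs x hx
    rw [DynAlg.twice, expQueries_follow rfl prefix_withResidual_step, expQueries_withResidual]
    push_cast
    refine add_le_add (hb xs x hx) ?_
    calc _ ≤ (A.withResidual.stateLaw f xs).expect fun p =>
          ((A.withResidual.step p x).result f).expect fun p' =>
            ((p'.2.drop p.2.length).length : ℝ≥0∞) * b := by
          refine PMF.expect_mono fun p hp => PMF.expect_mono fun p' hp' => ?_
          refine blockQueries_le_of_expected hb _ _ ?_
          have h := (mem_support_withResidual hA.subset_ground hx (p := p') (by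
            rw [stateLaw_append_singleton, PMF.mem_support_bind_iff]
            exact ⟨_, hp, hp'⟩)).2.1
          obtain ⟨t, ht⟩ := prefix_withResidual_step p x p' hp'
          rwa [← ht, List.drop_left, ht]
      _ ≤ (1 + min (2 * k : ℝ≥0∞) (A.expQueries f xs x)) * b := by
          simp only [PMF.expect_mul_const]
          exact mul_le_mul_left (expect_residual_le hA hx) _
      _ ≤ _ := by gcongr; exact hb xs x hx
  | expectedAmortized =>
    intro xs hxs
    have key : ∀ ys : List (Update V), Update.ValidSeq ys →
        ((A.withResidual.stateLaw f ys).expect fun p => (p.2.length : ℝ≥0∞)) ≤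
          ys.length + min (ys.length * (2 * k) : ℝ≥0∞) (A.expTotalQueries f ys) := by
      intro ys hys
      induction ys using List.reverseRecOn with
      | nil => simp [stateLaw_nil, PMF.expect_pure, withResidual]
      | append_singleton ys y ih =>
        calc _ = ((A.withResidual.stateLaw f ys).expect fun p => (p.2.length : ℝ≥0∞)) +
              (A.withResidual.stateLaw f ys).expect fun p =>
                ((A.withResidual.step p y).result f).expect fun p' =>
                  ((p'.2.drop p.2.length).length : ℝ≥0∞) := by
              rw [stateLaw_append_singleton, PMF.expect_bind, ← PMF.expect_add]
              congr 1
              funext p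
              rw [← PMF.expect_const ((A.withResidual.step p y).result f) (p.2.length : ℝ≥0∞),
                ← PMF.expect_add]
              refine PMF.expect_congr fun p' hp' => ?_
              obtain ⟨t, ht⟩ := prefix_withResidual_step p y p' hp'
              rw [← ht, List.drop_left]
              simp
          _ ≤ (ys.length + min (ys.length * (2 * k) : ℝ≥0∞) (A.expTotalQueries f ys)) +
              (1 + min (2 * k : ℝ≥0∞) (A.expQueries f ys y)) :=
              add_le_add (ih hys.of_append) (expect_residual_le hA hys)
          _ ≤ _ := by
              rw [add_add_add_comm, expTotalQueries_append_singleton]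
              simp only [List.length_append, List.length_singleton, Nat.cast_add, Nat.cast_one]
              refine add_le_add_right (le_min ?_ ?_) _
              · rw [add_mul, one_mul]
                exact add_le_add (min_le_left _ _) (min_le_left _ _)
              · exact add_le_add (min_le_right _ _) (min_le_right _ _)
    rw [DynAlg.twice, expTotalQueries_follow rfl prefix_withResidual_step,
      expTotalQueries_withResidual]
    push_cast
    rw [mul_add]
    refine add_le_add (hb xs hxs) ?_
    calc _ ≤ (A.withResidual.stateLaw f xs).expect fun p => (p.2.length : ℝ≥0∞) * b :=
          PMF.expect_mono fun p hp =>
            hb _ (mem_support_withResidual hA.subset_ground hxs hp).2.1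
      _ ≤ (xs.length + min (xs.length * (2 * k) : ℝ≥0∞) (A.expTotalQueries f xs)) * b := by
          rw [PMF.expect_mul_const]
          exact mul_le_mul_left (key xs hxs) _
      _ ≤ (xs.length + min (xs.length * (2 * k) : ℝ≥0∞) (xs.length * b)) * b := by
          gcongr
          exact hb xs hxs
      _ = _ := by
          rw [← mul_min, ← mul_assoc, mul_add, mul_one]

end residual

end DynAlg

/-! ### Running many algorithms in parallel on parts of the universe -/

namespace DynAlg

variable {V : Type u}

/-- The program that lets the algorithms with index in the list `l` process the update `x`. -/
def runAll (D : ℤ → DynAlg V) (x : Update V) :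
    List ℤ → (∀ i, (D i).State) → QueryProg V (∀ i, (D i).State)
  | [], S => .done S
  | i :: l, S => ((D i).step (S i) x).bind fun s => runAll D x l (Function.update S i s)

section runAll

variable (D : ℤ → DynAlg V) (f : Finset V → ℝ) (x : Update V)

theorem map_result_runAll (i : ℤ) {l : List ℤ} (hl : l.Nodup) (S : ∀ i, (D i).State) :
    ((runAll D x l S).result f).map (fun S' => S' i) =
      if i ∈ l then ((D i).step (S i) x).result f else PMF.pure (S i) := by
  induction l generalizing S with
  | nil => simp [runAll, QueryProg.result_done, PMF.pure_map]
  | cons j l ih =>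
    rw [List.nodup_cons] at hl
    simp only [runAll, QueryProg.result_bind, PMF.map_bind, ih hl.2]
    by_cases hij : i = j
    · subst hij
      simp [hl.1]
    · simp only [Function.update_of_ne hij, PMF.bind_const, List.mem_cons, hij, false_or]

theorem cost_runAll {l : List ℤ} (hl : l.Nodup) (S : ∀ i, (D i).State) :
    (runAll D x l S).cost f = (l.map fun i => ((D i).step (S i) x).cost f).sum := by
  induction l generalizing S with
  | nil => simp [runAll, QueryProg.cost_done]
  | cons j l ih =>
    rw [List.nodup_cons] at hl
    simp only [runAll, QueryProg.cost_bind, ih hl.2, List.map_cons, List.sum_cons]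
    congr 1
    have : ∀ s, (l.map fun i => ((D i).step (Function.update S j s i) x).cost f) =
        l.map fun i => ((D i).step (S i) x).cost f := fun s =>
      List.map_congr_left fun i hi => by
        rw [Function.update_of_ne (by rintro rfl; exact hl.1 hi)]
    simp only [this, PMF.expect_const]

end runAll

/-- The algorithm that, on an update of the element `v`, queries the values at `∅` and `{v}`, and
passes the update on to the algorithms `D i` with `i ∈ rel r`, where `r` is the value at `{v}`. Its
memory consists of the memories of all `D i`, the ground set, and a table of the values queried by
the algorithm itself. -/
abbrev parallel [DecidableEq V] (D : ℤ → DynAlg V) (rel : ℝ → Finset ℤ) : DynAlg V where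
  State := (∀ i, (D i).State) × Finset V × (Finset V → ℝ)
  init := (fun i => (D i).init, ∅, 0)
  step S x := .ask ∅ fun e => .ask {x.elem} fun r =>
    (runAll D x (rel r).toList S.1).bind fun S' =>
      .done (S', x.apply S.2.1, Function.update (Function.update S.2.2 ∅ e) {x.elem} r)
  output _ := ∅

/-- The updates that `DynAlg.parallel` passes on to the algorithm with index `i`. -/
def subseq (f : Finset V → ℝ) (rel : ℝ → Finset ℤ) (i : ℤ) (xs : List (Update V)) :
    List (Update V) :=
  xs.filter fun x => i ∈ rel (f {x.elem})

section parallel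

variable {D : ℤ → DynAlg V} {rel : ℝ → Finset ℤ} {f : Finset V → ℝ}

theorem subseq_append_singleton (i : ℤ) (xs : List (Update V)) (x : Update V) :
    subseq f rel i (xs ++ [x]) =
      if i ∈ rel (f {x.elem}) then subseq f rel i xs ++ [x] else subseq f rel i xs := by
  rw [subseq, List.filter_append, List.filter_singleton]
  split_ifs with h
  · rw [decide_eq_true h, cond_true]; rfl
  · rw [decide_eq_false h, cond_false, List.append_nil]; rfl

theorem sum_length_subseq_le {L : ℕ} (hL : ∀ v, (rel (f {v})).card ≤ L) (xs : List (Update V))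
    (I : Finset ℤ) : ∑ i ∈ I, (subseq f rel i xs).length ≤ xs.length * L := by
  induction xs using List.reverseRecOn with
  | nil => simp [subseq]
  | append_singleton xs x ih =>
    have h : ∀ i, (subseq f rel i (xs ++ [x])).length =
        (subseq f rel i xs).length + if i ∈ rel (f {x.elem}) then 1 else 0 := by
      intro i
      rw [subseq_append_singleton]
      split_ifs <;> simp
    simp only [h]
    rw [Finset.sum_add_distrib, Finset.sum_ite_mem, List.length_append, List.length_singleton,
      add_mul, one_mul]
    refine add_le_add ih ?_
    rw [Finset.sum_const, smul_eq_mul, mul_one]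
    exact (Finset.card_le_card Finset.inter_subset_right).trans (hL _)

variable [DecidableEq V]

theorem validSeq_subseq (i : ℤ) {xs : List (Update V)} (h : Update.ValidSeq xs) :
    Update.ValidSeq (subseq f rel i xs) :=
  (Update.filter_spec (fun v => i ∈ rel (f {v})) xs h).1

theorem ground_subseq (i : ℤ) {xs : List (Update V)} (h : Update.ValidSeq xs) :
    Update.ground (subseq f rel i xs) =
      (Update.ground xs).filter fun v => i ∈ rel (f {v}) :=
  (Update.filter_spec (fun v => i ∈ rel (f {v})) xs h).2

theorem result_parallel_step (S : (parallel D rel).State) (x : Update V) :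
    ((parallel D rel).step S x).result f =
      ((runAll D x (rel (f {x.elem})).toList S.1).result f).map fun S' =>
        (S', x.apply S.2.1,
          Function.update (Function.update S.2.2 ∅ (f ∅)) {x.elem} (f {x.elem})) := by
  simp only [QueryProg.result_ask, QueryProg.result_bind, QueryProg.result_done]
  rfl

/-- Each of the parallel algorithms behaves as if it were run alone on its own updates. -/
theorem map_stateLaw_parallel (i : ℤ) (xs : List (Update V)) :
    ((parallel D rel).stateLaw f xs).map (fun S => S.1 i) =
      (D i).stateLaw f (subseq f rel i xs) := by
  induction xs using List.reverseRecOn with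
  | nil => simp [stateLaw_nil, PMF.pure_map, subseq]
  | append_singleton xs x ih =>
    rw [stateLaw_append_singleton, PMF.map_bind, subseq_append_singleton]
    have h : ∀ S : (parallel D rel).State,
        (((parallel D rel).step S x).result f).map (fun S => S.1 i) =
          if i ∈ rel (f {x.elem}) then ((D i).step (S.1 i) x).result f else PMF.pure (S.1 i) := by
      intro S
      rw [result_parallel_step, PMF.map_comp]
      refine (map_result_runAll D f x i (Finset.nodup_toList _) S.1).trans ?_
      simp only [Finset.mem_toList]
    simp only [h]
    split_ifs
    · rw [stateLaw_append_singleton, ← ih, PMF.bind_map]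
      rfl
    · rw [← ih]
      rfl

theorem mem_support_parallel {xs : List (Update V)} {S : (parallel D rel).State}
    (hS : S ∈ ((parallel D rel).stateLaw f xs).support) :
    (∀ i, S.1 i ∈ ((D i).stateLaw f (subseq f rel i xs)).support) ∧
      S.2.1 = Update.ground xs ∧ (xs ≠ [] → S.2.2 ∅ = f ∅) ∧
      ∀ v ∈ Update.ground xs, S.2.2 {v} = f {v} := by
  refine ⟨fun i => ?_, ?_⟩
  · rw [← map_stateLaw_parallel, PMF.mem_support_map_iff]
    exact ⟨S, hS, rfl⟩
  induction xs using List.reverseRecOn generalizing S with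
  | nil =>
    rw [stateLaw_nil, PMF.mem_support_pure_iff] at hS
    subst hS
    simp [Update.ground]
  | append_singleton xs x ih =>
    rw [stateLaw_append_singleton, PMF.mem_support_bind_iff] at hS
    obtain ⟨S₀, hS₀, hS⟩ := hS
    obtain ⟨h1, -, h3⟩ := ih hS₀
    rw [result_parallel_step, PMF.mem_support_map_iff] at hS
    obtain ⟨S', -, rfl⟩ := hS
    refine ⟨?_, fun _ => ?_, fun v hv => ?_⟩
    · simp only [h1, Update.ground_append_singleton]
    · simp only
      rw [Function.update_of_ne (Finset.singleton_ne_empty _).symm, Function.update_self]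
    · simp only
      by_cases hvx : v = x.elem
      · rw [hvx, Function.update_self]
      · rw [Function.update_of_ne (fun e => hvx (Finset.singleton_injective e)),
          Function.update_of_ne (Finset.singleton_ne_empty _)]
        apply h3
        rw [Update.ground_append_singleton] at hv
        cases x with
        | insert w => exact Finset.mem_of_mem_insert_of_ne hv hvx
        | delete w => exact Finset.mem_of_mem_erase hv

theorem expQueries_parallel (xs : List (Update V)) (x : Update V) :
    (parallel D rel).expQueries f xs x =
      2 + ∑ i ∈ rel (f {x.elem}), (D i).expQueries f (subseq f rel i xs) x := by
  simp only [expQueries_eq, ← map_stateLaw_parallel, PMF.expect_map]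
  simp only [QueryProg.cost_ask, QueryProg.cost_bind, QueryProg.cost_done,
    PMF.expect_const, add_zero, PMF.expect_add, cost_runAll _ _ _ (Finset.nodup_toList _),
    Finset.sum_map_toList, PMF.expect_sum]
  rw [add_assoc, one_add_one_eq_two, add_comm]

theorem expTotalQueries_parallel (xs : List (Update V)) (I : Finset ℤ)
    (hI : ∀ x ∈ xs, rel (f {x.elem}) ⊆ I) :
    (parallel D rel).expTotalQueries f xs =
      xs.length * 2 + ∑ i ∈ I, (D i).expTotalQueries f (subseq f rel i xs) := by
  induction xs using List.reverseRecOn with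
  | nil => simp [expTotalQueries_nil, subseq]
  | append_singleton xs x ih =>
    rw [expTotalQueries_append_singleton, ih fun y hy => hI y (List.mem_append_left _ hy),
      expQueries_parallel]
    have h : ∀ i, (D i).expTotalQueries f (subseq f rel i (xs ++ [x])) =
        (D i).expTotalQueries f (subseq f rel i xs) +
          if i ∈ rel (f {x.elem}) then (D i).expQueries f (subseq f rel i xs) x else 0 := by
      intro i
      rw [subseq_append_singleton]
      split_ifs
      · rw [expTotalQueries_append_singleton]
      · rw [add_zero]
    simp only [h]
    rw [Finset.sum_add_distrib, Finset.sum_ite_mem, Finset.inter_eq_right.2 (hI x (by simp)),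
      List.length_append, List.length_singleton]
    push_cast
    ring

theorem QueriesLE.parallel {b : ℝ≥0} {m : QueryMeasure} {L : ℕ}
    (hL : ∀ v, (rel (f {v})).card ≤ L) (hD : ∀ i, (D i).QueriesLE f b m) :
    (parallel D rel).QueriesLE f (2 + L * b) m := by
  cases m with
  | expected =>
    intro xs x hx
    rw [expQueries_parallel]
    push_cast
    refine add_le_add_right ?_ _
    calc _ ≤ ∑ i ∈ rel (f {x.elem}), (b : ℝ≥0∞) := by
          refine Finset.sum_le_sum fun i hi => hD i _ x ?_
          have h := validSeq_subseq (f := f) (rel := rel) i hx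
          rwa [subseq_append_singleton, if_pos hi] at h
      _ ≤ _ := by
          rw [Finset.sum_const, nsmul_eq_mul]
          gcongr
          exact hL _
  | expectedAmortized =>
    intro xs hxs
    classical
    rw [expTotalQueries_parallel xs (xs.toFinset.biUnion fun x => rel (f {x.elem}))
      fun x hx => Finset.subset_biUnion_of_mem (fun x : Update V => rel (f {x.elem}))
        (List.mem_toFinset.2 hx)]
    push_cast
    rw [mul_add]
    refine add_le_add_right ?_ _
    calc _ ≤ ∑ i ∈ xs.toFinset.biUnion fun x => rel (f {x.elem}),
            ((subseq f rel i xs).length : ℝ≥0∞) * b :=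
          Finset.sum_le_sum fun i _ => hD i _ (validSeq_subseq i hxs)
      _ ≤ _ := by
          rw [← Finset.sum_mul, ← mul_assoc]
          gcongr
          exact_mod_cast sum_length_subseq_le hL xs _

end parallel

/-! ### Reporting the better of a stored set and a random subset -/

section randomSubset

variable [Finite V]

/-- Draw a uniformly random subset of `S`. -/
def drawSubset (S : Finset V) : QueryProg V (Finset V) :=
  .rand ((PMF.uniformOfFinset S.powerset S.powerset_nonempty).map (exists_injective_nat (Finset V)).choose)
    fun i => .done (Function.invFun (exists_injective_nat (Finset V)).choose i)

theorem result_drawSubset (f : Finset V → ℝ) (S : Finset V) :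
    (drawSubset S).result f = PMF.uniformOfFinset S.powerset S.powerset_nonempty := by
  rw [drawSubset, QueryProg.result_rand]
  simp only [QueryProg.result_done]
  change PMF.map _ (PMF.map _ _) = _
  rw [PMF.map_comp, Function.invFun_comp (exists_injective_nat (Finset V)).choose_spec, PMF.map_id]

theorem cost_drawSubset (f : Finset V → ℝ) (S : Finset V) : (drawSubset S).cost f = 0 := by
  simp [drawSubset, QueryProg.cost_rand, QueryProg.cost_done, PMF.expect_const]

/-- The algorithm that runs `D` and, after each update, draws a random subset of the set `base s`,
where `s` is the memory of `D`, and reports it if its value is at least `(best s).2`. Otherwise it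
reports `(best s).1`. -/
abbrev withRandomSubset (D : DynAlg V) (best : D.State → Finset V × ℝ)
    (base : D.State → Finset V) : DynAlg V where
  State := D.State × Finset V
  init := (D.init, ∅)
  step q x := (D.step q.1 x).bind fun s => (drawSubset (base s)).bind fun R =>
    .ask R fun r => .done (s, if (best s).2 ≤ r then R else (best s).1)
  output q := q.2

variable (D : DynAlg V) (best : D.State → Finset V × ℝ) (base : D.State → Finset V)
  (f : Finset V → ℝ)

theorem result_withRandomSubset_step (q : (D.withRandomSubset best base).State) (x : Update V) :
    ((D.withRandomSubset best base).step q x).result f =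
      ((D.step q.1 x).result f).bind fun s =>
        (PMF.uniformOfFinset (base s).powerset (Finset.powerset_nonempty _)).map fun R =>
          (s, if (best s).2 ≤ f R then R else (best s).1) := by
  simp only [QueryProg.result_bind, QueryProg.result_ask, QueryProg.result_done,
    result_drawSubset]
  rfl

theorem map_stateLaw_withRandomSubset (xs : List (Update V)) :
    ((D.withRandomSubset best base).stateLaw f xs).map Prod.fst = D.stateLaw f xs :=
  map_stateLaw (D' := D.withRandomSubset best base) f Prod.fst rfl (fun s x => by
    rw [result_withRandomSubset_step, PMF.map_bind]
    have h (a : D.State) (p : PMF (Finset V)) : p.map (fun _ => a) = PMF.pure a :=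
      PMF.map_const p a
    simp only [PMF.map_comp, Function.comp_def, h]
    exact PMF.bind_pure _) xs

theorem stateLaw_withRandomSubset (xs : List (Update V)) (x : Update V) :
    (D.withRandomSubset best base).stateLaw f (xs ++ [x]) =
      (D.stateLaw f (xs ++ [x])).bind fun s =>
        (PMF.uniformOfFinset (base s).powerset (Finset.powerset_nonempty _)).map fun R =>
          (s, if (best s).2 ≤ f R then R else (best s).1) := by
  rw [stateLaw_append_singleton, stateLaw_append_singleton,
    ← map_stateLaw_withRandomSubset D best base, PMF.bind_bind, PMF.bind_map]
  exact congrArg _ (funext fun q => result_withRandomSubset_step D best base f q x)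

theorem expQueries_withRandomSubset (xs : List (Update V)) (x : Update V) :
    (D.withRandomSubset best base).expQueries f xs x = D.expQueries f xs x + 1 := by
  rw [expQueries_eq, expQueries_eq, ← map_stateLaw_withRandomSubset D best base, PMF.expect_map]
  simp only [QueryProg.cost_bind, cost_drawSubset, QueryProg.cost_ask, QueryProg.cost_done,
    zero_add, PMF.expect_add, PMF.expect_const]

end randomSubset

end DynAlg

/-! ### Submodular functions -/

namespace IsNonnegSubmodular

variable {V : Type u} [DecidableEq V] {f : Finset V → ℝ}

theorem insert_sub_le (hf : IsNonnegSubmodular f) {v : V} {S : Finset V} (hv : v ∉ S) :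
    f (insert v S) - f S ≤ f {v} - f ∅ := by
  have h := hf.submodular {v} S
  rw [Finset.singleton_inter_of_notMem hv, ← Finset.insert_eq] at h
  linarith

theorem union_le (hf : IsNonnegSubmodular f) {S O : Finset V} {τ : ℝ} (hτ : 0 ≤ τ)
    (h : ∀ v ∈ O, f (insert v S) ≤ f S + τ) : f (S ∪ O) ≤ f S + O.card * τ := by
  induction O using Finset.induction_on with
  | empty => simp
  | insert a O ha ih =>
    have ih := ih fun v hv => h v (Finset.mem_insert_of_mem hv)
    rw [Finset.card_insert_of_notMem ha, Finset.union_insert]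
    push_cast
    by_cases haS : a ∈ S
    · rw [Finset.insert_eq_of_mem (Finset.mem_union_left _ haS)]
      linarith
    · have h1 := hf.submodular (insert a S) (S ∪ O)
      have h2 : insert a S ∪ (S ∪ O) = insert a (S ∪ O) := by
        ext; simp only [Finset.mem_union, Finset.mem_insert]; tauto
      have h3 : insert a S ∩ (S ∪ O) = S := by
        ext w
        simp only [Finset.mem_union, Finset.mem_insert, Finset.mem_inter]
        constructor
        · rintro ⟨rfl | h, h' | h'⟩ <;> tauto
        · tauto
      rw [h2, h3] at h1
      have := h a (Finset.mem_insert_self _ _)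
      linarith

theorem le_empty (hf : IsNonnegSubmodular f) (h : ∀ v, f {v} ≤ f ∅) (A : Finset V) :
    f A ≤ f ∅ := by
  have := hf.union_le (S := ∅) (O := A) le_rfl fun v _ => by simpa using h v
  simpa using this

/-- A uniformly random subset of `S` has in expectation at least a quarter of the value of any
fixed `T ⊆ S`: the four sets obtained from `R ⊆ S` by complementing it inside `T` or inside `S \ T`
have together at least the value of `T`. -/
theorem le_sum_powerset (hf : IsNonnegSubmodular f) {S T : Finset V} (hT : T ⊆ S) :
    (S.powerset.card : ℝ) * f T ≤ 4 * ∑ R ∈ S.powerset, f R := by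
  have flip : ∀ U ⊆ S, ∑ R ∈ S.powerset, f (symmDiff R U) = ∑ R ∈ S.powerset, f R := by
    intro U hU
    have hmem : ∀ R ∈ S.powerset, symmDiff R U ∈ S.powerset := fun R hR => by
      rw [Finset.mem_powerset] at hR ⊢
      exact symmDiff_le_sup.trans (sup_le hR hU)
    exact Finset.sum_nbij' (fun R => symmDiff R U) (fun R => symmDiff R U) hmem hmem
      (fun R _ => symmDiff_symmDiff_cancel_right U R)
      (fun R _ => symmDiff_symmDiff_cancel_right U R) (fun _ _ => rfl)
  have key : ∀ R ∈ S.powerset, f T ≤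
      f R + f (symmDiff R T) + f (symmDiff R (S \ T)) + f (symmDiff R S) := by
    intro R hR
    rw [Finset.mem_powerset] at hR
    have h1 := hf.submodular R (symmDiff R T)
    have h2 := hf.submodular (symmDiff R (S \ T)) (symmDiff R S)
    have h3 := hf.submodular (R ∪ symmDiff R T) (symmDiff R (S \ T) ∪ symmDiff R S)
    have h4 : (R ∪ symmDiff R T) ∩ (symmDiff R (S \ T) ∪ symmDiff R S) = T := by
      ext v
      have := @hR v
      have := @hT v
      simp only [Finset.mem_inter, Finset.mem_union, Finset.mem_symmDiff, Finset.mem_sdiff]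
      tauto
    rw [h4] at h3
    have := hf.nonneg (R ∩ symmDiff R T)
    have := hf.nonneg (symmDiff R (S \ T) ∩ symmDiff R S)
    have := hf.nonneg ((R ∪ symmDiff R T) ∪ (symmDiff R (S \ T) ∪ symmDiff R S))
    linarith
  have h := Finset.sum_le_sum key
  rw [Finset.sum_const, nsmul_eq_mul, Finset.sum_add_distrib, Finset.sum_add_distrib,
    Finset.sum_add_distrib, flip T hT, flip _ Finset.sdiff_subset, flip S subset_rfl] at h
  linarith

/-- Two disjoint sets `S₁`, `S₂` to which no element of `O` can be added with a gain above `τ`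
certify an upper bound for `f O`, up to the value of the part of `O` that lies in `S₁`. -/
theorem le_of_marginals (hf : IsNonnegSubmodular f) {S₁ S₂ O : Finset V} {k : ℕ} {τ : ℝ}
    (hτ : 0 ≤ τ) (hO : O.card ≤ k) (hdisj : Disjoint S₁ S₂)
    (h₁ : ∀ v ∈ O, f (insert v S₁) ≤ f S₁ + τ) (h₂ : ∀ v ∈ O \ S₁, f (insert v S₂) ≤ f S₂ + τ) :
    f O ≤ f S₁ + f S₂ + f (S₁ ∩ O) + 2 * (k * τ) := by
  have a1 := hf.union_le hτ h₁
  have a2 := hf.union_le hτ h₂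
  have b1 : (O.card : ℝ) * τ ≤ k * τ := mul_le_mul_of_nonneg_right (by exact_mod_cast hO) hτ
  have b2 : ((O \ S₁).card : ℝ) * τ ≤ k * τ := mul_le_mul_of_nonneg_right
    (by exact_mod_cast (Finset.card_le_card Finset.sdiff_subset).trans hO) hτ
  have c1 := hf.submodular (S₁ ∪ O) (S₂ ∪ O \ S₁)
  have c2 := hf.submodular (O \ S₁) (S₁ ∩ O)
  have d1 : (S₁ ∪ O) ∩ (S₂ ∪ O \ S₁) = O \ S₁ := by
    ext v
    have := @Finset.disjoint_left.1 hdisj v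
    simp only [Finset.mem_inter, Finset.mem_union, Finset.mem_sdiff]
    tauto
  have d2 : O \ S₁ ∪ S₁ ∩ O = O := by
    ext v
    simp only [Finset.mem_inter, Finset.mem_union, Finset.mem_sdiff]
    tauto
  rw [d1] at c1
  rw [d2] at c2
  have := hf.nonneg (S₁ ∪ O ∪ (S₂ ∪ O \ S₁))
  have := hf.nonneg (O \ S₁ ∩ (S₁ ∩ O))
  linarith

end IsNonnegSubmodular

/-- `S` is a `τ`-thresholding solution on the ground set `W`. -/
def IsThresholdSet {V : Type u} [DecidableEq V] (f : Finset V → ℝ) (k : ℕ) (τ : ℝ)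
    (W S : Finset V) : Prop :=
  S ⊆ W ∧ S.card ≤ k ∧ ((S.card = k ∧ k * τ ≤ f S) ∨
    (S.card < k ∧ ∀ v ∈ W \ S, f (insert v S) - f S < τ))

/-! ### Guessing the threshold -/

/-- The exponents `i` with `(1 + δ) ^ i ≤ r ≤ k * (1 + δ) ^ i`. -/
def guesses (k : ℕ) (δ r : ℝ) : Finset ℤ :=
  if 0 < r then
    Finset.Icc ⌈Real.log (r / k) / Real.log (1 + δ)⌉ ⌊Real.log r / Real.log (1 + δ)⌋
  else ∅

theorem mem_guesses {k : ℕ} (hk : 0 < k) {δ : ℝ} (hδ : 0 < δ) {r : ℝ} {i : ℤ} :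
    i ∈ guesses k δ r ↔ (1 + δ) ^ i ≤ r ∧ r ≤ k * (1 + δ) ^ i := by
  have hk' : (0 : ℝ) < k := by exact_mod_cast hk
  have hpos : (0 : ℝ) < (1 + δ) ^ i := by positivity
  have hlog : 0 < Real.log (1 + δ) := Real.log_pos (by linarith)
  rw [guesses]
  split_ifs with hr
  · rw [Finset.mem_Icc, Int.ceil_le, Int.le_floor, div_le_iff₀ hlog, le_div_iff₀ hlog,
      ← Real.log_zpow, Real.log_le_log_iff (by positivity) hpos, Real.log_le_log_iff hpos hr,
      div_le_iff₀' hk', and_comm]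
  · simp only [Finset.notMem_empty, false_iff, not_and]
    intro h
    linarith

/-- An upper bound for the number of guesses. -/
def numGuesses (k : ℕ) (δ : ℝ) : ℕ := ⌊Real.log k / Real.log (1 + δ)⌋₊ + 1

theorem card_guesses_le {k : ℕ} (hk : 0 < k) {δ : ℝ} (hδ : 0 < δ) (r : ℝ) :
    (guesses k δ r).card ≤ numGuesses k δ := by
  have hk' : (0 : ℝ) < k := by exact_mod_cast hk
  have hlog : 0 < Real.log (1 + δ) := Real.log_pos (by linarith)
  rw [guesses]
  split_ifs with hr
  · rw [Int.card_Icc, Int.toNat_le, numGuesses]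
    have h1 := Int.le_ceil (Real.log (r / k) / Real.log (1 + δ))
    have h2 := Int.floor_le (Real.log r / Real.log (1 + δ))
    have h3 : Real.log r / Real.log (1 + δ) - Real.log (r / k) / Real.log (1 + δ) =
        Real.log k / Real.log (1 + δ) := by
      rw [Real.log_div hr.ne' hk'.ne']
      ring
    have h4 : ⌊Real.log r / Real.log (1 + δ)⌋ - ⌈Real.log (r / k) / Real.log (1 + δ)⌉ ≤
        ⌊Real.log k / Real.log (1 + δ)⌋ := by
      rw [Int.le_floor]
      push_cast
      linarith
    have h5 : ⌊Real.log k / Real.log (1 + δ)⌋ ≤ (⌊Real.log k / Real.log (1 + δ)⌋₊ : ℤ) := by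
      rw [Int.natCast_floor_eq_floor]
      exact div_nonneg (Real.log_natCast_nonneg k) hlog.le
    push_cast
    linarith
  · simp

theorem numGuesses_le {k : ℕ} (hk : 0 < k) {ε : ℝ} (hε : 0 < ε) (hε1 : ε ≤ 1) :
    (numGuesses k (ε / 2) : ℝ) ≤ 5 * (ε⁻¹ * Real.log (max k 2 : ℕ)) ∧
      1 ≤ 2 * (ε⁻¹ * Real.log (max k 2 : ℕ)) := by
  have hk' : (0 : ℝ) < k := by exact_mod_cast hk
  have hε' : 1 ≤ ε⁻¹ := (one_le_inv₀ hε).2 hε1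
  have h1 : Real.log k ≤ Real.log (max k 2 : ℕ) :=
    Real.log_le_log hk' (by exact_mod_cast le_max_left k 2)
  have h2 : (1 : ℝ) / 2 ≤ Real.log (max k 2 : ℕ) := by
    have := Real.log_two_gt_d9
    have h : Real.log 2 ≤ Real.log (max k 2 : ℕ) :=
      Real.log_le_log two_pos (by exact_mod_cast le_max_right k 2)
    linarith
  have h3 : 1 ≤ 2 * (ε⁻¹ * Real.log (max k 2 : ℕ)) := by nlinarith
  refine ⟨?_, h3⟩
  have h4 : ε / 3 ≤ Real.log (1 + ε / 2) := by
    have h := Real.one_sub_inv_le_log_of_pos (x := 1 + ε / 2) (by positivity)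
    refine le_trans ?_ h
    rw [← sub_nonneg]
    have : 1 - (1 + ε / 2)⁻¹ - ε / 3 = ε * (1 - ε) / (6 * (1 + ε / 2)) := by
      field_simp
      ring
    rw [this]
    exact div_nonneg (mul_nonneg hε.le (by linarith)) (by positivity)
  have h5 : Real.log k / Real.log (1 + ε / 2) ≤ 3 * (ε⁻¹ * Real.log (max k 2 : ℕ)) := by
    calc _ ≤ Real.log k / (ε / 3) :=
          div_le_div_of_nonneg_left (Real.log_natCast_nonneg k) (by positivity) h4
      _ = 3 * (ε⁻¹ * Real.log k) := by field_simp
      _ ≤ _ := by gcongr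
  have h6 := Nat.floor_le (div_nonneg (Real.log_natCast_nonneg k)
    ((by positivity : (0 : ℝ) ≤ ε / 3).trans h4))
  rw [numGuesses, Nat.cast_add, Nat.cast_one]
  linarith

theorem exists_guess {k : ℕ} (hk : 0 < k) {δ : ℝ} (hδ : 0 < δ) {M : ℝ} (hM : 0 < M) :
    ∃ i : ℤ, M < k * (1 + δ) ^ i ∧ k * (1 + δ) ^ i ≤ (1 + δ) * M := by
  have hk' : (0 : ℝ) < k := by exact_mod_cast hk
  obtain ⟨n, h1, h2⟩ := exists_mem_Ico_zpow (div_pos hM hk') (by linarith : 1 < 1 + δ)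
  refine ⟨n + 1, (div_lt_iff₀' hk').1 h2, ?_⟩
  rw [zpow_add_one₀ (by positivity)]
  rw [le_div_iff₀' hk'] at h1
  nlinarith

/-- If `M` bounds the values of the empty set, of the singletons and of the solutions for the
threshold `τ`, where `k * τ` slightly exceeds `M`, then no solution is full, and the part of the
optimum outside of `S₁` is paid for by `M`. Elements that are not passed on to this threshold have a
value below `τ`, so that their gain is below `τ` as well. -/
theorem IsNonnegSubmodular.le_of_isThresholdSet {V : Type u} [DecidableEq V] {f : Finset V → ℝ}
    (hf : IsNonnegSubmodular f) {k : ℕ} (hk : 0 < k) {δ : ℝ} (hδ : 0 < δ) {M : ℝ} {i : ℤ}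
    {W S₁ S₂ : Finset V}
    (hi : M < k * (1 + δ) ^ i) (hi' : k * (1 + δ) ^ i ≤ (1 + δ) * M)
    (hW : ∀ v ∈ W, f {v} ≤ M) (hM₁ : f S₁ ≤ M) (hM₂ : f S₂ ≤ M)
    (h₁ : IsThresholdSet f k ((1 + δ) ^ i) (W.filter fun v => i ∈ guesses k δ (f {v})) S₁)
    (h₂ : IsThresholdSet f k ((1 + δ) ^ i)
      ((W.filter fun v => i ∈ guesses k δ (f {v})) \ S₁) S₂)
    {O : Finset V} (hO : O ⊆ W) (hOk : O.card ≤ k) :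
    f O ≤ (4 + 2 * δ) * M + f (S₁ ∩ O) := by
  have hτ : (0 : ℝ) < (1 + δ) ^ i := by positivity
  have small : ∀ S : Finset V, ∀ v ∈ W, v ∉ W.filter (fun v => i ∈ guesses k δ (f {v})) →
      f (insert v S) ≤ f S + (1 + δ) ^ i := by
    intro S v hv hvf
    by_cases hvS : v ∈ S
    · rw [Finset.insert_eq_of_mem hvS]
      linarith
    have h := hf.insert_sub_le hvS
    have h0 := hf.nonneg ∅
    have : f {v} < (1 + δ) ^ i := by
      by_contra! hlt
      exact hvf (Finset.mem_filter.2 ⟨hv, (mem_guesses hk hδ).2 ⟨hlt, ((hW v hv).trans_lt hi).le⟩⟩)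
    linarith
  obtain ⟨-, -, ⟨-, hbad⟩ | ⟨-, g₁⟩⟩ := h₁
  · linarith
  obtain ⟨hsub, -, ⟨-, hbad⟩ | ⟨-, g₂⟩⟩ := h₂
  · linarith
  have := hf.le_of_marginals (S₁ := S₁) (S₂ := S₂) hτ.le hOk
    (Finset.disjoint_left.2 fun v hv hv' => (Finset.mem_sdiff.1 (hsub hv')).2 hv)
    (fun v hv => by
      by_cases hvf : v ∈ W.filter fun v => i ∈ guesses k δ (f {v})
      · by_cases hvS : v ∈ S₁
        · rw [Finset.insert_eq_of_mem hvS]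
          linarith
        · linarith [g₁ v (Finset.mem_sdiff.2 ⟨hvf, hvS⟩)]
      · exact small _ v (hO hv) hvf)
    (fun v hv => by
      rw [Finset.mem_sdiff] at hv
      by_cases hvf : v ∈ W.filter fun v => i ∈ guesses k δ (f {v})
      · by_cases hvS : v ∈ S₂
        · rw [Finset.insert_eq_of_mem hvS]
          linarith
        · linarith [g₂ v (Finset.mem_sdiff.2 ⟨Finset.mem_sdiff.2 ⟨hvf, hv.2⟩, hvS⟩)]
      · exact small _ v (hO hv.1) hvf)
  linarith

/-! ### The approximation algorithm -/

theorem PMF.expect_uniformOfFinset {α : Type*} (s : Finset α) (hs : s.Nonempty) (h : α → ℝ)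
    (hh : ∀ a, 0 ≤ h a) :
    (PMF.uniformOfFinset s hs).expect (fun a => ENNReal.ofReal (h a)) =
      ENNReal.ofReal ((∑ a ∈ s, h a) / s.card) := by
  have hc : (0 : ℝ) < s.card := by exact_mod_cast hs.card_pos
  rw [PMF.expect, tsum_eq_sum (s := s) fun a ha => by
      rw [PMF.uniformOfFinset_apply_of_notMem hs ha, zero_mul],
    ENNReal.ofReal_div_of_pos hc, ENNReal.ofReal_sum_of_nonneg fun a _ => hh a,
    ENNReal.ofReal_natCast, ENNReal.div_eq_inv_mul, Finset.mul_sum]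
  exact Finset.sum_congr rfl fun a ha => by rw [PMF.uniformOfFinset_apply_of_mem hs ha]

/-- An element of `C` with maximal second component, if there is one. -/
def maximizer {α : Type u} (C : Set (Finset α × ℝ)) : Finset α × ℝ :=
  Classical.epsilon fun p => p ∈ C ∧ ∀ q ∈ C, q.2 ≤ p.2

theorem maximizer_spec {α : Type u} {C : Set (Finset α × ℝ)} (hC : C.Finite) (hne : C.Nonempty) :
    maximizer C ∈ C ∧ ∀ q ∈ C, q.2 ≤ (maximizer C).2 := by
  obtain ⟨p, hp, h⟩ := Set.exists_max_image C Prod.snd hC hne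
  exact Classical.epsilon_spec (p := fun p => p ∈ C ∧ ∀ q ∈ C, q.2 ≤ p.2) ⟨p, hp, h⟩

namespace DynAlg

variable {V : Type u} [DecidableEq V]

theorem IsThresholding.isThresholdSet {A : DynAlg V} {f : Finset V → ℝ} {k : ℕ} {τ : ℝ}
    (hA : A.IsThresholding f k τ) {xs : List (Update V)} (hxs : Update.ValidSeq xs) {s : A.State}
    (hs : s ∈ (A.stateLaw f xs).support) :
    IsThresholdSet f k τ (Update.ground xs) (A.output s) :=
  ⟨hA.subset_ground xs hxs s hs, hA.card_le xs hxs s hs, hA.threshold xs hxs s hs⟩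

/-- The two thresholding solutions of `DynAlg.twice` together with their values. -/
abbrev twiceWithValues (A : DynAlg V) : DynAlg V :=
  (A.twice.observe fun q => A.output q.1.1).observe fun q => A.output q.1.2

section twiceWithValues

variable {A : DynAlg V}

/-- The first solution and its stored value. -/
def first (q : A.twiceWithValues.State) : Finset V × ℝ := (A.output q.1.1.1.1, q.1.2)

/-- The second solution and its stored value. -/
def second (q : A.twiceWithValues.State) : Finset V × ℝ := (A.output q.1.1.2, q.2)

theorem mem_support_twiceWithValues {f : Finset V → ℝ} {k : ℕ} {τ : ℝ}
    (hA : A.IsThresholding f k τ) {xs : List (Update V)} (hxs : Update.ValidSeq xs)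
    {q : A.twiceWithValues.State} (hq : q ∈ (A.twiceWithValues.stateLaw f xs).support) :
    IsThresholdSet f k τ (Update.ground xs) (first q).1 ∧
      IsThresholdSet f k τ (Update.ground xs \ (first q).1) (second q).1 ∧
      ((first q).2 = f (first q).1 ∨ first q = (∅, 0)) ∧
      ((second q).2 = f (second q).1 ∨ second q = (∅, 0)) := by
  obtain ⟨hq1, h2⟩ := mem_support_observe _ _ f hq
  obtain ⟨hq2, h1⟩ := mem_support_observe _ _ f hq1
  obtain ⟨hs, ys, hys, hg, hs'⟩ := mem_support_twice hA hxs hq2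
  have t1 := hA.isThresholdSet hxs hs
  have t2 := hA.isThresholdSet hys hs'
  rw [hg] at t2
  refine ⟨t1, t2, h1.imp id ?_, h2.imp id ?_⟩
  · rintro ⟨rfl, h⟩
    exact Prod.ext (Finset.subset_empty.1 t1.1) h
  · rintro ⟨rfl, h⟩
    exact Prod.ext (Finset.subset_empty.1 (t2.1.trans Finset.sdiff_subset)) h

theorem QueriesLE.twiceWithValues {f : Finset V → ℝ} {k : ℕ} {τ : ℝ} {b : ℝ≥0} {m : QueryMeasure}
    (hA : A.IsThresholding f k τ) (hb : A.QueriesLE f b m) :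
    A.twiceWithValues.QueriesLE f (b + (1 + min (2 * k : ℝ≥0) b) * b + 1 + 1) m :=
  ((hb.twice hA).of_expQueries_le fun xs x => by
    rw [expQueries_observe, ENNReal.coe_one]).of_expQueries_le fun xs x => by
      rw [expQueries_observe, ENNReal.coe_one]

end twiceWithValues

section approx

variable (A : ℤ → DynAlg V) (k : ℕ) (δ : ℝ)

/-- The two solutions for each threshold `(1 + δ) ^ i`, where an element is taken into account only
for the thresholds between a `k`-th of its value and its value. -/
abbrev allThresholds : DynAlg V :=
  parallel (fun i => (A i).twiceWithValues) (guesses k δ)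

variable {A k δ}

/-- The sets that are known to be feasible, with their stored values. -/
def candidates (S : (allThresholds A k δ).State) : Set (Finset V × ℝ) :=
  {p | p = (∅, S.2.2 ∅) ∨ (∃ v ∈ S.2.1, p = ({v}, S.2.2 {v})) ∨
    ∃ i, p = first (S.1 i) ∨ p = second (S.1 i)}

/-- The best of the feasible sets. -/
def bestCandidate (S : (allThresholds A k δ).State) : Finset V × ℝ := maximizer (candidates S)

/-- The first solution for the threshold `τ` for which `k * τ` slightly exceeds the largest stored
value. -/
def baseSet (S : (allThresholds A k δ).State) : Finset V :=
  (first (S.1 (Classical.epsilon fun i : ℤ =>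
    (bestCandidate S).2 < k * (1 + δ) ^ i ∧
      k * (1 + δ) ^ i ≤ (1 + δ) * (bestCandidate S).2))).1

variable {f : Finset V → ℝ} {xs : List (Update V)}

theorem first_second_spec (hA : ∀ i, (A i).IsThresholding f k ((1 + δ) ^ i))
    (hxs : Update.ValidSeq xs) {S : (allThresholds A k δ).State}
    (hS : S ∈ ((allThresholds A k δ).stateLaw f xs).support) (i : ℤ) :
    IsThresholdSet f k ((1 + δ) ^ i)
        ((Update.ground xs).filter fun v => i ∈ guesses k δ (f {v})) (first (S.1 i)).1 ∧
      IsThresholdSet f k ((1 + δ) ^ i)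
        (((Update.ground xs).filter fun v => i ∈ guesses k δ (f {v})) \ (first (S.1 i)).1)
        (second (S.1 i)).1 ∧
      ((first (S.1 i)).2 = f (first (S.1 i)).1 ∨ first (S.1 i) = (∅, 0)) ∧
      ((second (S.1 i)).2 = f (second (S.1 i)).1 ∨ second (S.1 i) = (∅, 0)) := by
  rw [← ground_subseq (f := f) (rel := guesses k δ) i hxs]
  exact mem_support_twiceWithValues (hA i) (validSeq_subseq i hxs)
    ((mem_support_parallel hS).1 i)

theorem candidates_spec (hk : 0 < k) (hA : ∀ i, (A i).IsThresholding f k ((1 + δ) ^ i))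
    (hxs : Update.ValidSeq xs) (hne : xs ≠ []) {S : (allThresholds A k δ).State}
    (hS : S ∈ ((allThresholds A k δ).stateLaw f xs).support) {p : Finset V × ℝ}
    (hp : p ∈ candidates S) :
    p.1 ⊆ Update.ground xs ∧ p.1.card ≤ k ∧ (p.2 = f p.1 ∨ p = (∅, 0)) := by
  obtain ⟨-, hW, h0, h1⟩ := mem_support_parallel hS
  rcases hp with rfl | ⟨v, hv, rfl⟩ | ⟨i, hp⟩
  · exact ⟨by simp, by simp, Or.inl (h0 hne)⟩
  · rw [hW] at hv
    exact ⟨by simpa using hv, (Finset.card_singleton v).trans_le hk, Or.inl (h1 v hv)⟩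
  · obtain ⟨t1, t2, e1, e2⟩ := first_second_spec hA hxs hS i
    rcases hp with rfl | rfl
    · exact ⟨t1.1.trans (Finset.filter_subset _ _), t1.2.1, e1⟩
    · exact ⟨t2.1.trans (Finset.sdiff_subset.trans (Finset.filter_subset _ _)), t2.2.1, e2⟩

variable [Finite V]

theorem bestCandidate_spec (hk : 0 < k) (hA : ∀ i, (A i).IsThresholding f k ((1 + δ) ^ i))
    (hxs : Update.ValidSeq xs) (hne : xs ≠ []) {S : (allThresholds A k δ).State}
    (hS : S ∈ ((allThresholds A k δ).stateLaw f xs).support) :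
    bestCandidate S ∈ candidates S ∧ ∀ q ∈ candidates S, q.2 ≤ (bestCandidate S).2 := by
  refine maximizer_spec ?_ ⟨_, Or.inl rfl⟩
  refine ((Set.finite_range fun B : Finset V => (B, f B)).union
    (Set.finite_singleton (∅, 0))).subset fun p hp => ?_
  refine (candidates_spec hk hA hxs hne hS hp).2.2.imp (fun h => ⟨p.1, ?_⟩) id
  exact Prod.ext rfl h.symm

/-- A random subset of the base set compensates for the part of an optimal set that is contained in
the base set. -/
theorem optValue_le_expect (hf : IsNonnegSubmodular f) (hk : 0 < k) (hδ : 0 < δ)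
    (hA : ∀ i, (A i).IsThresholding f k ((1 + δ) ^ i))
    (hxs : Update.ValidSeq xs) (hne : xs ≠ []) {S : (allThresholds A k δ).State}
    (hS : S ∈ ((allThresholds A k δ).stateLaw f xs).support) :
    ENNReal.ofReal (optValue f k (Update.ground xs) / (8 + 2 * δ)) ≤
      (PMF.uniformOfFinset (baseSet S).powerset (Finset.powerset_nonempty _)).expect fun R =>
        ENNReal.ofReal (f (if (bestCandidate S).2 ≤ f R then R else (bestCandidate S).1)) := by
  obtain ⟨hbest, hmax⟩ := bestCandidate_spec hk hA hxs hne hS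
  obtain ⟨-, hW, hT0, hT1⟩ := mem_support_parallel hS
  have hval := (candidates_spec hk hA hxs hne hS hbest).2.2
  set M := (bestCandidate S).2 with hM
  have hempty : f ∅ ≤ M := by
    rw [← hT0 hne]
    exact hmax _ (Or.inl rfl)
  have hM0 : 0 ≤ M := (hf.nonneg ∅).trans hempty
  have hsingle : ∀ v ∈ Update.ground xs, f {v} ≤ M := fun v hv => by
    rw [← hT1 v hv]
    exact hmax _ (Or.inr (Or.inl ⟨v, hW.symm ▸ hv, rfl⟩))
  -- A solution without updates has the stored value `0` instead of `f ∅`.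
  have hcand : ∀ p ∈ candidates S, f p.1 ≤ M := fun p hp => by
    rcases (candidates_spec hk hA hxs hne hS hp).2.2 with h | rfl
    · exact h ▸ hmax p hp
    · exact hempty
  have hMbest : M ≤ f (bestCandidate S).1 := by
    rcases hval with h | h
    · exact h.le
    · rw [hM, h]
      exact hf.nonneg _
  have hout : ∀ R, M ≤ f (if M ≤ f R then R else (bestCandidate S).1) ∧
      f R ≤ f (if M ≤ f R then R else (bestCandidate S).1) := by
    intro R
    split_ifs with h
    · exact ⟨h, le_rfl⟩
    · exact ⟨hMbest, (not_le.1 h).le.trans hMbest⟩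
  rw [PMF.expect_uniformOfFinset _ _ _ fun _ => hf.nonneg _]
  refine ENNReal.ofReal_le_ofReal ?_
  obtain ⟨O, hO, hopt⟩ := Finset.exists_mem_eq_sup'
    (s := (Update.ground xs).powerset.filter fun S => S.card ≤ k) ⟨∅, by simp⟩ f
  rw [Finset.mem_filter, Finset.mem_powerset] at hO
  rw [optValue, hopt]
  have hc : (0 : ℝ) < (baseSet S).powerset.card := by
    exact_mod_cast (Finset.powerset_nonempty _).card_pos
  have hsumM : ((baseSet S).powerset.card : ℝ) * M ≤
      ∑ R ∈ (baseSet S).powerset, f (if M ≤ f R then R else (bestCandidate S).1) := by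
    rw [← nsmul_eq_mul]
    exact Finset.card_nsmul_le_sum _ _ _ fun R _ => (hout R).1
  have hsumf : ∑ R ∈ (baseSet S).powerset, f R ≤
      ∑ R ∈ (baseSet S).powerset, f (if M ≤ f R then R else (bestCandidate S).1) :=
    Finset.sum_le_sum fun R _ => (hout R).2
  rw [div_le_div_iff₀ (by positivity) hc]
  rcases hM0.eq_or_lt with h0 | hMpos
  · have hle : f O ≤ 0 := by
      have := hf.union_le (S := ∅) (O := O) le_rfl fun v hv => by
        have := hsingle v (hO.1 hv)
        have := hf.nonneg ∅
        simp only [insert_empty_eq]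
        linarith
      simp only [Finset.empty_union, mul_zero, add_zero] at this
      linarith
    rw [← h0, mul_zero] at hsumM
    have : 0 ≤ (∑ R ∈ (baseSet S).powerset,
        f (if M ≤ f R then R else (bestCandidate S).1)) * (8 + 2 * δ) := by
      rw [← h0]
      positivity
    nlinarith
  · have hi := Classical.epsilon_spec (exists_guess hk hδ hMpos)
    set i := Classical.epsilon fun i : ℤ => M < k * (1 + δ) ^ i ∧ k * (1 + δ) ^ i ≤ (1 + δ) * M
    obtain ⟨t1, t2, -, -⟩ := first_second_spec hA hxs hS i
    have h := hf.le_of_isThresholdSet hk hδ hi.1 hi.2 hsingle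
      (hcand _ (Or.inr (Or.inr ⟨i, Or.inl rfl⟩))) (hcand _ (Or.inr (Or.inr ⟨i, Or.inr rfl⟩)))
      t1 t2 hO.1 hO.2
    have hb : baseSet S = (first (S.1 i)).1 := rfl
    have hq := hf.le_sum_powerset (S := baseSet S) (T := baseSet S ∩ O) Finset.inter_subset_left
    rw [← hb] at h
    nlinarith

variable (A k δ)

/-- The best stored candidate, or, if it is better, a random subset of the first solution for the
threshold that fits the value of this candidate. -/
abbrev approxAlg : DynAlg V :=
  (allThresholds A k δ).withRandomSubset bestCandidate baseSet

variable {A k δ}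

theorem isApprox_approxAlg (hf : IsNonnegSubmodular f) (hk : 0 < k) (hδ : 0 < δ)
    (hA : ∀ i, (A i).IsThresholding f k ((1 + δ) ^ i)) :
    (approxAlg A k δ).IsApprox f k (8 + 2 * δ) := by
  have feas : ∀ xs : List (Update V), Update.ValidSeq xs →
      ∀ q ∈ ((approxAlg A k δ).stateLaw f xs).support,
        q.2 ⊆ Update.ground xs ∧ q.2.card ≤ k := by
    intro xs hxs q hq
    rcases List.eq_nil_or_concat' xs with rfl | ⟨xs, x, rfl⟩
    · rw [stateLaw_nil, PMF.mem_support_pure_iff] at hq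
      subst hq
      simp
    · rw [stateLaw_withRandomSubset, PMF.mem_support_bind_iff] at hq
      obtain ⟨S, hS, hq⟩ := hq
      rw [PMF.mem_support_map_iff] at hq
      obtain ⟨R, hR, rfl⟩ := hq
      rw [PMF.mem_support_uniformOfFinset_iff, Finset.mem_powerset] at hR
      simp only
      split_ifs
      · have t := (first_second_spec hA hxs hS (Classical.epsilon fun i : ℤ =>
          (bestCandidate S).2 < k * (1 + δ) ^ i ∧
            k * (1 + δ) ^ i ≤ (1 + δ) * (bestCandidate S).2)).1
        exact ⟨hR.trans (t.1.trans (Finset.filter_subset _ _)),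
          (Finset.card_le_card hR).trans t.2.1⟩
      · have t := candidates_spec hk hA hxs (by simp) hS
          (bestCandidate_spec hk hA hxs (by simp) hS).1
        exact ⟨t.1, t.2.1⟩
  refine ⟨fun xs hxs q hq => (feas xs hxs q hq).1, fun xs hxs q hq => (feas xs hxs q hq).2, ?_⟩
  intro xs hxs
  change _ ≤ ((approxAlg A k δ).stateLaw f xs).expect fun q => ENNReal.ofReal (f q.2)
  rcases List.eq_nil_or_concat' xs with rfl | ⟨xs, x, rfl⟩
  · rw [stateLaw_nil, PMF.expect_pure]
    refine ENNReal.ofReal_le_ofReal ?_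
    have h : optValue f k (Update.ground []) ≤ f ∅ :=
      Finset.sup'_le _ _ fun B hB => by
        have : B = ∅ := by simpa [Update.ground] using (Finset.mem_filter.1 hB).1
        rw [this]
    exact (div_le_div_of_nonneg_right h (by positivity)).trans
      (div_le_self (hf.nonneg ∅) (by linarith))
  · rw [stateLaw_withRandomSubset, PMF.expect_bind]
    refine le_trans (PMF.expect_const _ _).ge (PMF.expect_mono fun S hS => ?_)
    rw [PMF.expect_map]
    exact optValue_le_expect hf hk hδ hA hxs (by simp) hS

theorem queriesLE_approxAlg {m : QueryMeasure} {b : ℝ≥0} (hk : 0 < k) (hδ : 0 < δ)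
    (hA : ∀ i, (A i).IsThresholding f k ((1 + δ) ^ i)) (hb : ∀ i, (A i).QueriesLE f b m) :
    (approxAlg A k δ).QueriesLE f
      (2 + numGuesses k δ * (b + (1 + min (2 * k : ℝ≥0) b) * b + 1 + 1) + 1) m :=
  (QueriesLE.parallel (fun v => card_guesses_le hk hδ (f {v}))
    fun i => (hb i).twiceWithValues (hA i)).of_expQueries_le fun xs x => by
      rw [expQueries_withRandomSubset, ENNReal.coe_one]

end approx

/-! ### Trivial instances and the final query bound -/

theorem QueriesLE.mono {A : DynAlg V} {f : Finset V → ℝ} {b b' : ℝ≥0} {m : QueryMeasure}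
    (h : A.QueriesLE f b m) (hb : b ≤ b') : A.QueriesLE f b' m := by
  have hb' : (b : ℝ≥0∞) ≤ b' := by exact_mod_cast hb
  cases m with
  | expected => exact fun xs x hx => (h xs x hx).trans hb'
  | expectedAmortized => exact fun xs hxs => (h xs hxs).trans (mul_le_mul_right hb' _)

theorem IsApprox.mono {A : DynAlg V} {f : Finset V → ℝ} (hf : IsNonnegSubmodular f) {k : ℕ}
    {α β : ℝ} (hα : 0 < α) (hαβ : α ≤ β) (h : A.IsApprox f k α) : A.IsApprox f k β := by
  refine ⟨h.subset_ground, h.card_le, fun xs hxs => le_trans ?_ (h.value_ge xs hxs)⟩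
  refine ENNReal.ofReal_le_ofReal (div_le_div_of_nonneg_left ?_ hα hαβ)
  exact (hf.nonneg ∅).trans (Finset.le_sup' f (by simp))

/-- The algorithm that always reports the empty set. -/
def empty (V : Type u) : DynAlg V where
  State := PUnit
  init := PUnit.unit
  step s _ := .done s
  output _ := ∅

theorem isApprox_empty {f : Finset V → ℝ} (hf : IsNonnegSubmodular f) {k : ℕ} {α : ℝ} (hα : 1 ≤ α)
    (h : ∀ A : Finset V, A.card ≤ k → f A ≤ f ∅) : (empty V).IsApprox f k α := by
  refine ⟨fun _ _ _ _ => Finset.empty_subset _, fun _ _ _ _ => Nat.zero_le _, fun xs _ => ?_⟩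
  change _ ≤ ((empty V).stateLaw f xs).expect fun _ => ENNReal.ofReal (f ∅)
  rw [PMF.expect_const]
  refine ENNReal.ofReal_le_ofReal ?_
  have hopt : optValue f k (Update.ground xs) ≤ f ∅ :=
    Finset.sup'_le _ _ fun B hB => h B (Finset.mem_filter.1 hB).2
  exact (div_le_div_of_nonneg_right hopt (by linarith)).trans (div_le_self (hf.nonneg ∅) hα)

theorem queriesLE_empty (f : Finset V → ℝ) (b : ℝ≥0) (m : QueryMeasure) :
    (empty V).QueriesLE f b m := by
  have h : ∀ xs x, (empty V).expQueries f xs x = 0 := fun xs x => by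
    rw [expQueries_eq]
    simp only [empty, QueryProg.cost_done, PMF.expect_const]
  cases m with
  | expected => exact fun xs x _ => by simp [h]
  | expectedAmortized => exact fun xs _ => by simp [expTotalQueries, h]

/-- If some singleton has a larger value than the empty set, then a thresholding algorithm with a
small threshold has to change its solution when the element is inserted first, and thus has to
query. -/
theorem IsThresholding.one_le {A : DynAlg V} {f : Finset V → ℝ} {k : ℕ} (hk : 0 < k) {v : V}
    (hA : A.IsThresholding f k (f {v} - f ∅)) {b : ℝ≥0} {m : QueryMeasure}
    (hb : A.QueriesLE f b m) : 1 ≤ b := by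
  have hvalid : Update.ValidSeq ([] ++ [Update.insert v]) := by
    simp [Update.ValidSeq, Update.ValidFrom, Update.Valid]
  have hle : A.expQueries f [] (.insert v) ≤ b := by
    cases m with
    | expected => exact hb [] _ hvalid
    | expectedAmortized =>
      have := hb _ hvalid
      rw [expTotalQueries_append_singleton, expTotalQueries_nil, zero_add] at this
      simpa using this
  have hge : 1 ≤ A.expQueries f [] (.insert v) := by
    change 1 ≤ (A.updateLaw f [] (.insert v)).expect fun y => (y.2.2 : ℝ≥0∞)
    refine le_trans (PMF.expect_const _ _).ge (PMF.expect_mono fun y hy => ?_)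
    have hchange := hA.change_le [] _ hvalid y hy
    rw [updateLaw, PMF.mem_support_bind_iff] at hy
    obtain ⟨s, hs, hy⟩ := hy
    rw [PMF.mem_support_map_iff] at hy
    obtain ⟨z, hz, rfl⟩ := hy
    have h0 : A.output s = ∅ :=
      Finset.subset_empty.1 (hA.subset_ground [] (by simp [Update.ValidSeq, Update.ValidFrom]) s hs)
    have hz' : z.1 ∈ (A.stateLaw f ([] ++ [.insert v])).support := by
      rw [stateLaw_append_singleton, PMF.mem_support_bind_iff]
      refine ⟨s, hs, ?_⟩
      rw [QueryProg.result, PMF.mem_support_map_iff]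
      exact ⟨z, hz, rfl⟩
    have h1 : A.output z.1 ≠ ∅ := by
      intro h
      rcases hA.threshold _ hvalid _ hz' with ⟨h2, -⟩ | ⟨-, h2⟩
      · rw [h, Finset.card_empty] at h2
        omega
      · have := h2 v (by simp [h, Update.ground, Update.apply])
        rw [h] at this
        simp at this
    simp only [h0, Finset.sdiff_empty, Finset.empty_sdiff, Finset.card_empty, add_zero] at hchange
    have := (Finset.card_pos.2 (Finset.nonempty_iff_ne_empty.2 h1)).trans_le hchange
    exact_mod_cast this
  exact_mod_cast hge.trans hle

end DynAlg

/-- The number of queries of `DynAlg.approxAlg` in terms of the bounds for its ingredients: `K` is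
the cardinality constraint, `L` the number of thresholds, `c * G` the number of queries of the
thresholding algorithms, and `ℓ` the logarithmic factor. -/
theorem queries_le_of_one_le {c G K L ℓ : ℝ≥0} (hb : 1 ≤ c * G) (hK : 1 ≤ K) (hL : L ≤ 5 * ℓ)
    (hℓ : 1 ≤ 2 * ℓ) :
    2 + L * (c * G + (1 + min (2 * K) (c * G)) * (c * G) + 1 + 1) + 1 ≤
      36 * (max 1 c * c) * (min K G * G * ℓ) := by
  obtain ⟨b, hbdef⟩ : ∃ b, b = c * G := ⟨_, rfl⟩
  rw [← hbdef] at hb ⊢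
  have hP1 : 1 ≤ min K b := le_min hK hb
  have hP : b ≤ min K b * b := le_mul_of_one_le_left zero_le hP1
  have h1 : min (2 * K) b ≤ 2 * min K b := by
    rw [mul_min]
    exact min_le_min_left _ (le_mul_of_one_le_left zero_le one_le_two)
  have h2 : min (2 * K) b * b ≤ 2 * (min K b * b) := by
    rw [← mul_assoc]
    exact mul_le_mul_left h1 _
  have h3 : b + (1 + min (2 * K) b) * b + 1 + 1 ≤ 6 * (min K b * b) := by
    rw [add_mul, one_mul]
    have : 1 ≤ min K b * b := hb.trans hP
    calc _ ≤ min K b * b + (min K b * b + 2 * (min K b * b)) + min K b * b + min K b * b := by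
          gcongr
      _ = _ := by ring
  have h4 : min K b * b ≤ max 1 c * c * (min K G * G) := by
    have : min K b ≤ max 1 c * min K G := by
      rw [mul_min, hbdef]
      exact min_le_min (le_mul_of_one_le_left zero_le (le_max_left _ _))
        (mul_le_mul_left (le_max_right _ _) _)
    calc min K b * b ≤ max 1 c * min K G * b := mul_le_mul_left this _
      _ = _ := by rw [hbdef]; ring
  have h5 : 1 ≤ 2 * ℓ * (min K b * b) := one_le_mul hℓ (hb.trans hP)
  calc _ ≤ 2 * (2 * ℓ * (min K b * b)) + 5 * ℓ * (6 * (min K b * b)) +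
        2 * ℓ * (min K b * b) := by
        gcongr
        exact le_mul_of_one_le_right zero_le h5
    _ = 36 * (min K b * b) * ℓ := by ring
    _ ≤ 36 * (max 1 c * c * (min K G * G)) * ℓ := by gcongr
    _ = _ := by ring

end

theorem theorem1 (c : ℝ≥0) :
    ∃ C : ℝ≥0, ∀ (V : Type u) [Fintype V] [DecidableEq V] (k : ℕ) (g : ℕ → ℕ → ℝ≥0)
      (𝓕 : Set (Finset V → ℝ)), (∀ f ∈ 𝓕, IsNonnegSubmodular f) →
      ∀ m : QueryMeasure,
      (∀ τ : ℝ, 0 < τ → ∃ A : DynAlg V, ∀ f ∈ 𝓕,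
        A.IsThresholding f k τ ∧ A.QueriesLE f (c * g (Fintype.card V) k) m) →
      ∀ ε : ℝ, 0 < ε → ε ≤ 1 →
        (∃ B : DynAlg V, ∀ f ∈ 𝓕, B.IsApprox f k (8 + ε) ∧
          B.QueriesLE f (C * (k + min (k : ℝ≥0) (g (Fintype.card V) k) * g (Fintype.card V) k *
            Real.toNNReal (ε⁻¹ * Real.log (max k 2 : ℕ)))) m) ∧
        (∃ B : DynAlg V, ∀ f ∈ 𝓕, B.IsApprox f k (10 + ε) ∧
          B.QueriesLE f (C * (min (k : ℝ≥0) (g (Fintype.card V) k) * g (Fintype.card V) k *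
            Real.toNNReal (ε⁻¹ * Real.log (max k 2 : ℕ)))) m) := by
  refine ⟨36 * (max 1 c * c), ?_⟩
  intro V _ _ k g 𝓕 h𝓕 m hthr ε hε hε1
  -- One algorithm serves both claims.
  suffices h : ∃ B : DynAlg V, ∀ f ∈ 𝓕, B.IsApprox f k (8 + ε) ∧
      B.QueriesLE f (36 * (max 1 c * c) * (min (k : ℝ≥0) (g (Fintype.card V) k) *
        g (Fintype.card V) k * Real.toNNReal (ε⁻¹ * Real.log (max k 2 : ℕ)))) m by
    obtain ⟨B, hB⟩ := h
    refine ⟨⟨B, fun f hf => ⟨(hB f hf).1, (hB f hf).2.mono ?_⟩⟩,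
      ⟨B, fun f hf => ⟨(hB f hf).1.mono (h𝓕 f hf) (by linarith) (by linarith), (hB f hf).2⟩⟩⟩
    gcongr
    exact le_add_of_nonneg_left zero_le
  by_cases htriv : ∀ f ∈ 𝓕, ∀ A : Finset V, A.card ≤ k → f A ≤ f ∅
  · exact ⟨DynAlg.empty V, fun f hf => ⟨DynAlg.isApprox_empty (h𝓕 f hf) (by linarith) (htriv f hf),
      DynAlg.queriesLE_empty f _ m⟩⟩
  push Not at htriv
  obtain ⟨f₀, hf₀, A₀, hA₀, hlt⟩ := htriv
  have hk : 0 < k := by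
    rcases k.eq_zero_or_pos with rfl | hk
    · rw [Finset.card_eq_zero.1 (Nat.le_zero.1 hA₀)] at hlt
      exact absurd hlt (lt_irrefl _)
    · exact hk
  obtain ⟨v, hv⟩ : ∃ v, f₀ ∅ < f₀ {v} := by
    by_contra! h
    exact absurd hlt (not_lt.2 ((h𝓕 f₀ hf₀).le_empty h A₀))
  have hb : 1 ≤ c * g (Fintype.card V) k := by
    obtain ⟨A, hA⟩ := hthr (f₀ {v} - f₀ ∅) (sub_pos.2 hv)
    exact (hA f₀ hf₀).1.one_le hk (hA f₀ hf₀).2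
  have hδ : 0 < ε / 2 := by positivity
  choose A hA using fun i : ℤ => hthr ((1 + ε / 2) ^ i) (by positivity)
  refine ⟨DynAlg.approxAlg A k (ε / 2), fun f hf => ⟨?_, ?_⟩⟩
  · have h := DynAlg.isApprox_approxAlg (h𝓕 f hf) hk hδ fun i => (hA i f hf).1
    rwa [mul_div_cancel₀ ε two_ne_zero] at h
  · refine (DynAlg.queriesLE_approxAlg hk hδ (fun i => (hA i f hf).1)
      fun i => (hA i f hf).2).mono ?_
    obtain ⟨hL, hℓ⟩ := numGuesses_le hk hε hε1
    have hnn : 0 ≤ ε⁻¹ * Real.log (max k 2 : ℕ) := by linarith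
    refine queries_le_of_one_le hb (by exact_mod_cast hk) ?_ ?_
    · rw [← NNReal.coe_le_coe, NNReal.coe_mul, Real.coe_toNNReal _ hnn]
      exact hL
    · rw [← NNReal.coe_le_coe, NNReal.coe_mul, Real.coe_toNNReal _ hnn]
      exact hℓ
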